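/- Let $k<0$ and $p^+,p^-\in\mathbb{R}$. Let $\widehat{\mathfrak{nw}}$ be the affine Nappi--Witten algebra at level $k$ (with $b=2/k$), i.e. the complex Lie algebra generated by modes $J^{+}_n,J^-_n,J_n,T_n$ ($n\in\mathbb{Z}$) with $$[J^+_m,J^-_n]=2iT_{m+n}+km\,\delta_{m+n,0},\quad [J_m,J^\pm_n]=\pm iJ^\pm_{m+n},\quad [J_m,T_n]=\tfrac{k}{2}m\,\delta_{m+n,0},\quad [J_m,J_n]=\tfrac{kb}{2}m\,\delta_{m+n,0}=m\,\delta_{m+n,0},$$ all other commutators of modes being zero (the central element acts as the number $k$). Let $\widehat V_+^{p^+,p^-}$ (respectively $\widehat V_-^{p^+,p^-}$) be the Verma module generated by a vector $|p^+,p^-\rangle$ subject to: it is annihilated by all modes $J^\pm_n,J_n,T_n$ with $n>0$ and by $J^+_0$ (respectively $J^-_0$), and $T_0|p^+,p^-\rangle=ip^+|p^+,p^-\rangle$, $J_0|p^+,p^-\rangle=ip^-|p^+,p^-\rangle$. On each of the modules considered below there is exactly one Hermitian form $\langle\cdot|\cdot\rangle$ with $\langle p^+,p^-|p^+,p^-\rangle=1$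 for which $(J^\pm_n)^\dagger=-J^\mp_{-n}$, $J_n^\dagger=-J_{-n}$, $T_n^\dagger=-T_{-n}$; the norm of a state $\psi$ means $\langle\psi|\psi\rangle$. Put $X_n=J_n-T_n$. Then: 1. if $0<p^+\le -k/2$, every $\psi\in\widehat V_+^{p^+,p^-}$ with $X_n\psi=0$ for all $n>0$ has non-negative norm; 2. if $k/2\le p^+<0$, every $\psi\in\widehat V_-^{p^+,p^-}$ with $X_n\psi=0$ for all $n>0$ has non-negative norm. -/

import Mathlib

namespace NappiWitten

/-- The modes `J⁺ₙ`, `J⁻ₙ`, `Jₙ`, `Tₙ` (`n ∈ ℤ`) of the four Nappi–Witten currents. -/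
inductive Mode : Type
  | Jp (n : ℤ)
  | Jm (n : ℤ)
  | J (n : ℤ)
  | T (n : ℤ)

/-- The free associative unital complex algebra on the modes. -/
abbrev FreeModes : Type := FreeAlgebra ℂ Mode

/-- A mode, as an element of the free algebra. -/
abbrev FreeModes.of (g : Mode) : FreeModes := FreeAlgebra.ι ℂ g

/-- The central term `c δ_{m+n,0}`. -/
noncomputable def central (c : ℝ) (m n : ℤ) : FreeModes :=
  if m + n = 0 then algebraMap ℂ FreeModes (c : ℂ) else 0

open FreeModes in
/-- The commutation relations of the affine Nappi–Witten algebra at level `k`, for the invariant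
form with parameter `b`; the central element is set equal to the number `k`. -/
inductive CommRel (k b : ℝ) : FreeModes → FreeModes → Prop
  | Jp_Jm (m n : ℤ) : CommRel k b
      (of (.Jp m) * of (.Jm n) - of (.Jm n) * of (.Jp m))
      ((2 * Complex.I) • of (.T (m + n)) + central (k * m) m n)
  | J_Jp (m n : ℤ) : CommRel k b
      (of (.J m) * of (.Jp n) - of (.Jp n) * of (.J m)) (Complex.I • of (.Jp (m + n)))
  | J_Jm (m n : ℤ) : CommRel k b
      (of (.J m) * of (.Jm n) - of (.Jm n) * of (.J m)) (-(Complex.I • of (.Jm (m + n))))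
  | J_T (m n : ℤ) : CommRel k b
      (of (.J m) * of (.T n) - of (.T n) * of (.J m)) (central (k / 2 * m) m n)
  | J_J (m n : ℤ) : CommRel k b
      (of (.J m) * of (.J n) - of (.J n) * of (.J m)) (central (k * b / 2 * m) m n)
  | Jp_Jp (m n : ℤ) : CommRel k b
      (of (.Jp m) * of (.Jp n) - of (.Jp n) * of (.Jp m)) 0
  | Jm_Jm (m n : ℤ) : CommRel k b
      (of (.Jm m) * of (.Jm n) - of (.Jm n) * of (.Jm m)) 0
  | T_Jp (m n : ℤ) : CommRel k b
      (of (.T m) * of (.Jp n) - of (.Jp n) * of (.T m)) 0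
  | T_Jm (m n : ℤ) : CommRel k b
      (of (.T m) * of (.Jm n) - of (.Jm n) * of (.T m)) 0
  | T_T (m n : ℤ) : CommRel k b
      (of (.T m) * of (.T n) - of (.T n) * of (.T m)) 0

/-- The enveloping algebra of the affine Nappi–Witten algebra at level `k`: its left modules are
exactly the level `k` representations. -/
abbrev Env (k b : ℝ) : Type := RingQuot (CommRel k b)

/-- A mode, as an element of the enveloping algebra. -/
noncomputable def mode (k b : ℝ) (g : Mode) : Env k b :=
  RingQuot.mkAlgHom ℂ (CommRel k b) (FreeModes.of g)

/-- The two series of modules: highest weight (`+`) and lowest weight (`-`). -/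
inductive Series : Type
  | highest
  | lowest

/-- The zero mode that annihilates the highest (lowest) weight vector. -/
def Series.zeroMode : Series → Mode
  | .highest => .Jp 0
  | .lowest => .Jm 0

/-- The elements of the enveloping algebra that are required to annihilate the highest (lowest)
weight vector of weight `(p⁺, p⁻)`: all positive modes, the zero mode `J⁺₀` (resp. `J⁻₀`),
`T₀ - i p⁺` and `J₀ - i p⁻`. -/
inductive Annihilates (k b : ℝ) (s : Series) (pp pm : ℝ) : Env k b → Prop
  | Jp (n : ℤ) (hn : 0 < n) : Annihilates k b s pp pm (mode k b (.Jp n))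
  | Jm (n : ℤ) (hn : 0 < n) : Annihilates k b s pp pm (mode k b (.Jm n))
  | J (n : ℤ) (hn : 0 < n) : Annihilates k b s pp pm (mode k b (.J n))
  | T (n : ℤ) (hn : 0 < n) : Annihilates k b s pp pm (mode k b (.T n))
  | zero : Annihilates k b s pp pm (mode k b s.zeroMode)
  | T_zero : Annihilates k b s pp pm
      (mode k b (.T 0) - algebraMap ℂ (Env k b) (Complex.I * pp))
  | J_zero : Annihilates k b s pp pm
      (mode k b (.J 0) - algebraMap ℂ (Env k b) (Complex.I * pm))

/-- The left ideal generated by the elements annihilating the weight vector. -/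
def annIdeal (k b : ℝ) (s : Series) (pp pm : ℝ) : Submodule (Env k b) (Env k b) :=
  Submodule.span (Env k b) {x | Annihilates k b s pp pm x}

/-- The Verma module with highest (lowest) weight `(p⁺, p⁻)`. -/
abbrev Verma (k b : ℝ) (s : Series) (pp pm : ℝ) : Type := Env k b ⧸ annIdeal k b s pp pm

/-- The highest (lowest) weight vector `|p⁺, p⁻⟩`. -/
def vac (k b : ℝ) (s : Series) (pp pm : ℝ) : Verma k b s pp pm :=
  (annIdeal k b s pp pm).mkQ 1

/-- The adjoint of the mode `g` is `-g.conj`: `(J^±ₙ)† = -J^∓₋ₙ`, `Jₙ† = -J₋ₙ`, `Tₙ† = -T₋ₙ`. -/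
def Mode.conj : Mode → Mode
  | .Jp n => .Jm (-n)
  | .Jm n => .Jp (-n)
  | .J n => .J (-n)
  | .T n => .T (-n)

/-- `B` is the inner product of the module: the Hermitian form, conjugate linear in the first
argument, for which the modes have the prescribed adjoints and the weight vector has norm one.
It need not be positive. -/
structure IsInnerProduct {k b : ℝ} {s : Series} {pp pm : ℝ}
    (B : Verma k b s pp pm →ₗ⋆[ℂ] Verma k b s pp pm →ₗ[ℂ] ℂ) : Prop where
  hermitian : ∀ x y, starRingEnd ℂ (B x y) = B y x
  adjoint : ∀ (g : Mode) x y, B (mode k b g • x) y = -B x (mode k b g.conj • y)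
  normalized : B (vac k b s pp pm) (vac k b s pp pm) = 1

/-- The modes `Xₙ = Jₙ - Tₙ` of the timelike `û(1)` current. -/
noncomputable def X (k b : ℝ) (n : ℤ) : Env k b := mode k b (.J n) - mode k b (.T n)

/-- `ψ` is a `û(1)`-primary state. -/
def IsPrimary {k b : ℝ} {s : Series} {pp pm : ℝ} (ψ : Verma k b s pp pm) : Prop :=
  ∀ n : ℤ, 0 < n → X k b n • ψ = 0

/-- The module carries exactly one inner product, and no `û(1)`-primary state has negative norm
with respect to it. -/
def CosetUnitary (k b : ℝ) (s : Series) (pp pm : ℝ) : Prop :=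
  ∃ B : Verma k b s pp pm →ₗ⋆[ℂ] Verma k b s pp pm →ₗ[ℂ] ℂ,
    IsInnerProduct B ∧ (∀ B', IsInnerProduct B' → B' = B) ∧
      ∀ ψ : Verma k b s pp pm, IsPrimary ψ → 0 ≤ (B ψ ψ).re

end NappiWitten

namespace NappiWitten

/-! ### Structure of the Verma module and of the mode commutators -/

section Realization

variable {k b : ℝ} {s : Series} {pp pm : ℝ}

/-! The proof realizes the affine algebra on a Fock space where the norms can be read off. The space
is a polynomial ring whose variables create the oscillators of a boson `X` of level `1 - k`, a boson
`Y` of level `k - 1`, and a complex boson `P⁺`, `P⁻` with `[P⁺ₘ, P⁻ₙ] = (k m - 2 p) δ_{m+n,0}`. For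
nonzero modes put `T = k / (2 (k - 1)) (Y - X)` and `J = X + T`; let `T₀` be the scalar `i p`, and
`J₀` the scalar `i p⁻` plus `i` times the charge. Since `X` and `Y` have opposite levels, `T` is
null and all its modes commute. The currents `J^±` are `P^±` multiplied by exponentials of the
nonzero modes of `T` with coefficients `±2i/k`.

The algebra then closes for two reasons. `J₀` sees the charge of `P^±`, while `Jₘ` with `m ≠ 0` sees
only the single mode `T₋ₘ` in the exponential. In `[J⁺, J⁻]` the two exponentials are reciprocal, so
the commutator of `P^±` survives and supplies `T₀` and the central term; the mode number in that
central term is shifted by the expansion of the exponential, which amounts to a logarithmic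
derivative and supplies the remaining `T_{m+n}`. This is `dress_comm_dress`, used once for the
negative and once for the positive modes in `ChargedField.vertex_comm`; the result is
`modeRelations_freeField`.

The form with orthogonal monomials has the required adjoints (`fockForm_freeField`). A primary state
contains no `X` oscillator, and in the given range of `p⁺` all other oscillators have nonnegative
norm (`fockForm_primary_nonneg`). The Verma module maps to the Fock space by its universal property
and the form is pulled back (`cosetUnitary_of_representation`). Injectivity of this map is not
needed, hence neither is a Poincaré–Birkhoff–Witt basis. Uniqueness of the form, by normal ordering,
is `form_unique`. The lowest weight series reduces to the highest weight one by an automorphism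
(`ModeRelations.flip`). -/

theorem Env.induction {C : Env k b → Prop} (h_one : C 1)
    (h_add : ∀ x y, C x → C y → C (x + y)) (h_smul : ∀ (c : ℂ) x, C x → C (c • x))
    (h_mode : ∀ g x, C x → C (mode k b g * x)) (u : Env k b) : C u := by
  obtain ⟨a, rfl⟩ := RingQuot.mkAlgHom_surjective ℂ (CommRel k b) u
  suffices h : ∀ x, C x → C (RingQuot.mkAlgHom ℂ (CommRel k b) a * x) by
    simpa using h 1 h_one
  induction a using FreeAlgebra.induction with
  | grade0 r => intro x hx; simpa [Algebra.smul_def] using h_smul r x hx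
  | grade1 g => intro x hx; exact h_mode g x hx
  | mul a c ha hc => intro x hx; simpa [mul_assoc] using ha _ (hc x hx)
  | add a c ha hc => intro x hx; simpa [add_mul] using h_add _ _ (ha x hx) (hc x hx)

theorem Verma.eq_top_of_mode_mem (W : Submodule ℂ (Verma k b s pp pm))
    (h_vac : vac k b s pp pm ∈ W) (h_mode : ∀ g, ∀ x ∈ W, mode k b g • x ∈ W)
    (x : Verma k b s pp pm) : x ∈ W := by
  obtain ⟨u, rfl⟩ := Submodule.Quotient.mk_surjective _ x
  have key : ∀ u : Env k b, u • vac k b s pp pm ∈ W := by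
    intro u
    induction u using Env.induction with
    | h_one => simpa using h_vac
    | h_add x y hx hy => rw [add_smul]; exact W.add_mem hx hy
    | h_smul c x hx => rw [smul_assoc]; exact W.smul_mem c hx
    | h_mode g x hx => rw [mul_smul]; exact h_mode g _ hx
  have := key u
  rwa [vac, ← map_smul, smul_eq_mul, mul_one] at this

theorem annihilates_smul_vac {x : Env k b} (hx : Annihilates k b s pp pm x) :
    x • vac k b s pp pm = 0 := by
  rw [vac, ← map_smul, smul_eq_mul, mul_one, Submodule.mkQ_apply, Submodule.Quotient.mk_eq_zero]
  exact Submodule.subset_span hx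

/-- A representation of the affine algebra with a weight vector receives a map from the
Verma module. -/
theorem exists_verma_map {M : Type*} [AddCommGroup M] [Module ℂ M]
    (ρ : Env k b →ₐ[ℂ] Module.End ℂ M) (v : M)
    (hv : ∀ x, Annihilates k b s pp pm x → ρ x v = 0) :
    ∃ F : Verma k b s pp pm →ₗ[ℂ] M,
      F (vac k b s pp pm) = v ∧ ∀ (u : Env k b) x, F (u • x) = ρ u (F x) := by
  let _ : Module (Env k b) M := Module.compHom M ρ.toRingHom
  have hs : ∀ (u : Env k b) (m : M), u • m = ρ u m := fun _ _ => rfl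
  let Φ : Verma k b s pp pm →ₗ[Env k b] M :=
    (annIdeal k b s pp pm).liftQ (LinearMap.toSpanSingleton (Env k b) M v) (by
      rw [annIdeal, Submodule.span_le]
      intro x hx
      simpa [hs] using hv x hx)
  refine ⟨{ toFun := Φ, map_add' := map_add Φ, map_smul' := ?_ }, ?_, fun u x => ?_⟩
  · intro c x
    have : c • x = (algebraMap ℂ (Env k b) c) • x := by simp
    rw [this, map_smul, hs]
    simp
  · change Φ _ = _
    rw [vac, Submodule.mkQ_apply, Submodule.liftQ_apply]
    simp [hs]
  · change Φ _ = ρ u (Φ x)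
    rw [map_smul, hs]

/-- The only feature of the relations that normal ordering uses: modes and scalars together are
closed under commutators, so exchanging two letters of a word costs only shorter words. -/
theorem mode_comm (g h : Mode) : ∃ (c a : ℂ) (g' : Mode),
    mode k b g * mode k b h = mode k b h * mode k b g + c • mode k b g' + a • 1 := by
  have cen : ∀ (r : ℝ) (m n : ℤ), ∃ a : ℂ,
      RingQuot.mkAlgHom ℂ (CommRel k b) (central r m n) = a • 1 := by
    intro r m n
    unfold central
    split_ifs
    · exact ⟨r, by rw [AlgHom.commutes, Algebra.algebraMap_eq_smul_one]⟩
    · exact ⟨0, by simp⟩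
  have rel : ∀ {x y}, CommRel k b x y → RingQuot.mkAlgHom ℂ (CommRel k b) x =
      RingQuot.mkAlgHom ℂ (CommRel k b) y := fun h => RingQuot.mkAlgHom_rel ℂ h
  have swap : (∃ (c a : ℂ) (g' : Mode),
      mode k b h * mode k b g = mode k b g * mode k b h + c • mode k b g' + a • 1) →
      ∃ (c a : ℂ) (g' : Mode),
      mode k b g * mode k b h = mode k b h * mode k b g + c • mode k b g' + a • 1 := by
    rintro ⟨c, a, g', h'⟩
    exact ⟨-c, -a, g', by rw [h']; module⟩
  have zero : CommRel k b (FreeModes.of g * FreeModes.of h - FreeModes.of h * FreeModes.of g) 0 →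
      ∃ (c a : ℂ) (g' : Mode),
      mode k b g * mode k b h = mode k b h * mode k b g + c • mode k b g' + a • 1 := by
    intro h'
    refine ⟨0, 0, g, ?_⟩
    have := rel h'
    rw [map_sub, map_mul, map_mul, map_zero, sub_eq_zero] at this
    simpa [mode] using this
  have zero' : CommRel k b (FreeModes.of h * FreeModes.of g - FreeModes.of g * FreeModes.of h) 0 →
      ∃ (c a : ℂ) (g' : Mode),
      mode k b g * mode k b h = mode k b h * mode k b g + c • mode k b g' + a • 1 := by
    intro h'
    refine ⟨0, 0, g, ?_⟩
    have := rel h'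
    rw [map_sub, map_mul, map_mul, map_zero, sub_eq_zero] at this
    simpa [mode] using this.symm
  have one : ∀ {g h : Mode} {c : ℂ} {g' : Mode} {z : FreeModes}, CommRel k b
      (FreeModes.of g * FreeModes.of h - FreeModes.of h * FreeModes.of g)
      (c • FreeModes.of g' + z) →
      (∃ a : ℂ, RingQuot.mkAlgHom ℂ (CommRel k b) z = a • 1) → ∃ (c a : ℂ) (g' : Mode),
      mode k b g * mode k b h = mode k b h * mode k b g + c • mode k b g' + a • 1 := by
    rintro g h c g' z h' ⟨a, ha⟩
    refine ⟨c, a, g', ?_⟩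
    have := rel h'
    rw [map_sub, map_mul, map_mul, map_add, map_smul, ha, sub_eq_iff_eq_add'] at this
    simpa [mode, add_assoc] using this
  have z0 : ∃ a : ℂ, RingQuot.mkAlgHom ℂ (CommRel k b) 0 = a • 1 := ⟨0, by simp⟩
  have JJp : ∀ m n : ℤ, ∃ (c a : ℂ) (g' : Mode), mode k b (.J m) * mode k b (.Jp n) =
      mode k b (.Jp n) * mode k b (.J m) + c • mode k b g' + a • 1 := fun m n =>
    one (z := 0) (by simpa using CommRel.J_Jp m n) z0
  have JJm : ∀ m n : ℤ, ∃ (c a : ℂ) (g' : Mode), mode k b (.J m) * mode k b (.Jm n) =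
      mode k b (.Jm n) * mode k b (.J m) + c • mode k b g' + a • 1 := fun m n =>
    one (z := 0) (c := -Complex.I) (g' := .Jm (m + n)) (by simpa using CommRel.J_Jm m n) z0
  have JT : ∀ m n : ℤ, ∃ (c a : ℂ) (g' : Mode), mode k b (.J m) * mode k b (.T n) =
      mode k b (.T n) * mode k b (.J m) + c • mode k b g' + a • 1 := fun m n =>
    one (c := 0) (g' := .J 0) (by simpa using CommRel.J_T m n) (cen _ m n)
  cases g with
  | Jp m => cases h with
    | Jp n => exact zero (.Jp_Jp m n)
    | Jm n => exact one (.Jp_Jm m n) (cen _ _ _)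
    | J n => exact swap (JJp n m)
    | T n => exact zero' (.T_Jp n m)
  | Jm m => cases h with
    | Jp n => exact swap (one (.Jp_Jm n m) (cen _ _ _))
    | Jm n => exact zero (.Jm_Jm m n)
    | J n => exact swap (JJm n m)
    | T n => exact zero' (.T_Jm n m)
  | J m => cases h with
    | Jp n => exact JJp m n
    | Jm n => exact JJm m n
    | J n => exact one (c := 0) (g' := .J 0) (by simpa using CommRel.J_J m n) (cen _ m n)
    | T n => exact JT m n
  | T m => cases h with
    | Jp n => exact zero (.T_Jp m n)
    | Jm n => exact zero (.T_Jm m n)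
    | J n => exact swap (JT n m)
    | T n => exact zero (.T_T m n)

theorem Mode.conj_conj (g : Mode) : g.conj.conj = g := by
  cases g <;> simp [Mode.conj]

/-- The triangular decomposition in a form common to both series. In the first case `g` is a
creation operator, whose image is orthogonal to the weight vector for any invariant form; in the
second, `g` preserves the line of the weight vector. -/
theorem mode_smul_vac (g : Mode) : mode k b g.conj • vac k b s pp pm = 0 ∨
    ∃ c : ℂ, mode k b g • vac k b s pp pm = c • vac k b s pp pm := by
  have zero : ∀ {h : Mode}, Annihilates k b s pp pm (mode k b h) →
      ∃ c : ℂ, mode k b h • vac k b s pp pm = c • vac k b s pp pm := fun hx =>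
    ⟨0, by rw [annihilates_smul_vac hx]; exact (zero_smul ℂ (vac k b s pp pm)).symm⟩
  have eig : ∀ {h : Mode} {c : ℂ},
      Annihilates k b s pp pm (mode k b h - algebraMap ℂ (Env k b) c) →
      ∃ c : ℂ, mode k b h • vac k b s pp pm = c • vac k b s pp pm := fun {h c} hx =>
    ⟨c, by simpa [sub_smul, sub_eq_zero] using annihilates_smul_vac hx⟩
  cases g with
  | Jp n =>
    rcases lt_trichotomy n 0 with hn | rfl | hn
    · exact .inl (annihilates_smul_vac (.Jm _ (by omega)))
    · cases s
      · exact .inr (zero .zero)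
      · exact .inl (annihilates_smul_vac .zero)
    · exact .inr (zero (.Jp n hn))
  | Jm n =>
    rcases lt_trichotomy n 0 with hn | rfl | hn
    · exact .inl (annihilates_smul_vac (.Jp _ (by omega)))
    · cases s
      · exact .inl (annihilates_smul_vac .zero)
      · exact .inr (zero .zero)
    · exact .inr (zero (.Jm n hn))
  | J n =>
    rcases lt_trichotomy n 0 with hn | rfl | hn
    · exact .inl (annihilates_smul_vac (.J _ (by omega)))
    · exact .inr (eig .J_zero)
    · exact .inr (zero (.J n hn))
  | T n =>
    rcases lt_trichotomy n 0 with hn | rfl | hn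
    · exact .inl (annihilates_smul_vac (.T _ (by omega)))
    · exact .inr (eig .T_zero)
    · exact .inr (zero (.T n hn))

end Realization

/-! ### Normal ordering and uniqueness of invariant forms -/

section Words

variable {V ι : Type*} [AddCommGroup V] [Module ℂ V] (a : ι → Module.End ℂ V) (v : V)
  (S : Set ι)

/-- The state obtained by applying a word in the operators `a` to the vector `v`. -/
def wordState (l : List ι) : V := l.foldr (fun g x => a g x) v

/-- The vector `v`, together with the states obtained by applying an operator with label in `S` to
a word of length less than `n`. -/
def creationStates (n : ℕ) : Set V :=
  {x | x = v ∨ ∃ g ∈ S, ∃ l : List ι, l.length < n ∧ x = a g (wordState a v l)}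

theorem creationStates_mono {m n : ℕ} (h : m ≤ n) :
    creationStates a v S m ⊆ creationStates a v S n := by
  rintro x (rfl | ⟨g, hg, l, hl, rfl⟩)
  · exact .inl rfl
  · exact .inr ⟨g, hg, l, by omega, rfl⟩

variable {a v S}

/-- A letter outside `S` is moved to the right past a leading creation operator. The exchanged word
still begins with a letter of `S`, the correction terms are shorter words covered by induction, and
a letter that reaches `v` becomes a scalar. -/
theorem wordState_mem_span
    (hcomm : ∀ g h, ∃ (c d : ℂ) (g' : ι), a g * a h = a h * a g + c • a g' + d • 1)
    (hv : ∀ g ∉ S, ∃ c : ℂ, a g v = c • v) (n : ℕ) : ∀ l : List ι, l.length ≤ n →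
    wordState a v l ∈ Submodule.span ℂ (creationStates a v S n) := by
  induction n with
  | zero =>
    intro l hl
    obtain rfl : l = [] := List.length_eq_zero_iff.1 (by omega)
    exact Submodule.subset_span (.inl rfl)
  | succ n ih =>
    intro l hl
    rcases l with _ | ⟨h, l⟩
    · exact Submodule.subset_span (.inl rfl)
    rw [List.length_cons] at hl
    by_cases hh : h ∈ S
    · exact Submodule.subset_span (.inr ⟨h, hh, l, by omega, rfl⟩)
    obtain ⟨c, hc⟩ := hv h hh
    have mono := Submodule.span_mono (R := ℂ) (creationStates_mono a v S n.le_succ)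
    change a h (wordState a v l) ∈ _
    have hl' := ih l (by omega)
    generalize wordState a v l = y at hl'
    -- By induction the rest of the word is a combination of creation states, so `h` need only be
    -- applied to one of these.
    induction hl' using Submodule.span_induction with
    | zero => simp
    | add x y _ _ hx hy => rw [map_add]; exact add_mem hx hy
    | smul d x _ hx => rw [map_smul]; exact Submodule.smul_mem _ d hx
    | mem x hx =>
      rcases hx with rfl | ⟨g, hg, l', hl', rfl⟩
      · rw [hc]
        exact Submodule.smul_mem _ c (Submodule.subset_span (.inl rfl))
      · obtain ⟨c', d, g', e⟩ := hcomm h g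
        have e' : a h (a g (wordState a v l')) = a g (wordState a v (h :: l')) +
            c' • wordState a v (g' :: l') + d • wordState a v l' :=
          LinearMap.congr_fun e (wordState a v l')
        rw [e']
        refine add_mem (add_mem ?_ (Submodule.smul_mem _ c' (mono (ih _ ?_))))
          (Submodule.smul_mem _ d (mono (ih _ (by omega))))
        · exact Submodule.subset_span (.inr ⟨g, hg, h :: l', by simpa using hl', rfl⟩)
        · simpa using hl'

/-- A cyclic module is spanned by its cyclic vector and the image of the creation operators. -/
theorem induction_creation
    (hcomm : ∀ g h, ∃ (c d : ℂ) (g' : ι), a g * a h = a h * a g + c • a g' + d • 1)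
    (hv : ∀ g ∉ S, ∃ c : ℂ, a g v = c • v)
    (hcyc : ∀ W : Submodule ℂ V, v ∈ W → (∀ g, ∀ x ∈ W, a g x ∈ W) → ∀ x, x ∈ W)
    (W : Submodule ℂ V) (h_vac : v ∈ W) (h_mode : ∀ g ∈ S, ∀ x, a g x ∈ W) (x : V) : x ∈ W := by
  have hw : ∀ l, wordState a v l ∈ W := fun l =>
    Submodule.span_le.2 (by
      rintro y (rfl | ⟨g, hg, l', -, rfl⟩)
      · exact h_vac
      · exact h_mode g hg _) (wordState_mem_span hcomm hv l.length l le_rfl)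
  have hx : x ∈ Submodule.span ℂ (Set.range (wordState a v)) := by
    refine hcyc (Submodule.span ℂ (Set.range (wordState a v))) (Submodule.subset_span ⟨[], rfl⟩) ?_ x
    intro g y hy
    induction hy using Submodule.span_induction with
    | zero => simp
    | add x y _ _ hx hy => rw [map_add]; exact add_mem hx hy
    | smul a x _ hx => rw [map_smul]; exact Submodule.smul_mem _ a hx
    | mem x hx =>
      obtain ⟨l, rfl⟩ := hx
      exact Submodule.subset_span ⟨g :: l, rfl⟩
  exact Submodule.span_le.2 (by rintro _ ⟨l, rfl⟩; exact hw l) hx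

/-- A form on a cyclic module for which the operators have adjoints is determined by the norm of
the cyclic vector. -/
theorem form_unique {B B' : V →ₗ⋆[ℂ] V →ₗ[ℂ] ℂ} (σ : ι → ι) (hσ : ∀ g, σ (σ g) = g)
    (hcomm : ∀ g h, ∃ (c d : ℂ) (g' : ι), a g * a h = a h * a g + c • a g' + d • 1)
    (hv : ∀ g, a (σ g) v = 0 ∨ ∃ c : ℂ, a g v = c • v)
    (hcyc : ∀ W : Submodule ℂ V, v ∈ W → (∀ g, ∀ x ∈ W, a g x ∈ W) → ∀ x, x ∈ W)
    (hB : ∀ g x y, B (a g x) y = -B x (a (σ g) y))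
    (hB' : ∀ g x y, B' (a g x) y = -B' x (a (σ g) y)) (hvv : B' v v = B v v) : B' = B := by
  have hvac : B' v = B v := by
    ext y
    -- Both functionals `B v` and `B' v` vanish on the image of every `a g` with `a (σ g) v = 0`, so
    -- they agree once they agree at `v`.
    refine induction_creation (S := {g | a (σ g) v = 0}) hcomm
      (fun g hg => (hv g).resolve_left hg) hcyc (LinearMap.ker (B' v - B v)) ?_ ?_ y
      |> fun h => by simpa [sub_eq_zero] using h
    · simp [hvv]
    · intro g (hg : a (σ g) v = 0) x
      have h1 := hB (σ g) v x
      have h2 := hB' (σ g) v x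
      rw [hg, map_zero, LinearMap.zero_apply, hσ, zero_eq_neg] at h1 h2
      simp [h1, h2]
  ext x y
  have : x ∈ LinearMap.ker (B' - B) := by
    refine hcyc _ (by simp [hvac]) (fun g x hx => ?_) x
    rw [LinearMap.mem_ker, LinearMap.sub_apply, sub_eq_zero] at hx ⊢
    ext y
    rw [hB, hB', hx]
  rw [LinearMap.mem_ker, LinearMap.sub_apply, sub_eq_zero] at this
  rw [this]

end Words

/-! ### Unitarity from a realization -/

section Representation

variable {k b : ℝ} {s : Series} {pp pm : ℝ}

theorem IsInnerProduct.unique {B B' : Verma k b s pp pm →ₗ⋆[ℂ] Verma k b s pp pm →ₗ[ℂ] ℂ}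
    (hB : IsInnerProduct B) (hB' : IsInnerProduct B') : B' = B := by
  refine form_unique (a := fun g => Algebra.lsmul ℂ ℂ (Verma k b s pp pm) (mode k b g))
    (v := vac k b s pp pm) Mode.conj Mode.conj_conj (fun g h => ?_) mode_smul_vac
    Verma.eq_top_of_mode_mem hB.adjoint hB'.adjoint (by rw [hB.normalized, hB'.normalized])
  obtain ⟨c, d, g', e⟩ := mode_comm (k := k) (b := b) g h
  refine ⟨c, d, g', ?_⟩
  rw [← map_mul, e, map_add, map_add, map_mul, map_smul, map_smul, map_one]

/-- A representation with an invariant Hermitian form, nonnegative on the primary states, proves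
unitarity of the coset. -/
theorem cosetUnitary_of_representation {M : Type*} [AddCommGroup M] [Module ℂ M]
    (ρ : Env k b →ₐ[ℂ] Module.End ℂ M) (v : M)
    (hv : ∀ x, Annihilates k b s pp pm x → ρ x v = 0)
    (C : M →ₗ⋆[ℂ] M →ₗ[ℂ] ℂ) (hC : ∀ x y, starRingEnd ℂ (C x y) = C y x)
    (hadj : ∀ g x y, C (ρ (mode k b g) x) y = -C x (ρ (mode k b g.conj) y))
    (hnorm : C v v = 1)
    (hpos : ∀ x, (∀ n : ℤ, 0 < n → ρ (X k b n) x = 0) → 0 ≤ (C x x).re) :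
    CosetUnitary k b s pp pm := by
  obtain ⟨F, hF, hFs⟩ := exists_verma_map ρ v hv
  have hB : IsInnerProduct ((C.comp F).compl₂ F) := by
    refine ⟨fun x y => hC _ _, fun g x y => ?_, ?_⟩
    · simp [hFs, hadj]
    · simp [hF, hnorm]
  refine ⟨_, hB, fun B' hB' => hB.unique hB', fun ψ hψ => ?_⟩
  refine hpos (F ψ) fun n hn => ?_
  rw [← hFs, hψ n hn, map_zero]

end Representation

end NappiWitten

namespace NappiWitten

open Filter Finset

/-! ### Locally finite sums of operators -/

section LocallyFinite

variable {M : Type*} [AddCommGroup M] [Module ℂ M]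

/-- A sequence of operators, only finitely many of which act nontrivially on each vector. -/
def LocallyFinite (a : ℕ → Module.End ℂ M) : Prop := ∀ v, ∀ᶠ j in atTop, a j v = 0

theorem LocallyFinite.eventually_sum {a : ℕ → Module.End ℂ M} (h : LocallyFinite a) (v : M) :
    ∀ᶠ K in atTop, ∑ᶠ j, a j v = ∑ j ∈ range K, a j v := by
  obtain ⟨L, hL⟩ := eventually_atTop.1 (h v)
  filter_upwards [eventually_ge_atTop L] with K hK
  refine finsum_eq_finsetSum_of_support_subset _ fun j hj => ?_
  by_contra hj'
  exact hj (hL j (by simp at hj'; omega))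

open Classical in
/-- The sum of a locally finite sequence of operators. -/
noncomputable def locSum (a : ℕ → Module.End ℂ M) : Module.End ℂ M :=
  if h : LocallyFinite a then
    { toFun := fun v => ∑ᶠ j, a j v
      map_add' := fun v w => by
        obtain ⟨K, h1, h2, h3⟩ := ((h.eventually_sum v).and ((h.eventually_sum w).and
          (h.eventually_sum (v + w)))).exists
        rw [h1, h2, h3, ← sum_add_distrib]
        simp
      map_smul' := fun c v => by
        obtain ⟨K, h1, h2⟩ := ((h.eventually_sum v).and (h.eventually_sum (c • v))).exists
        rw [h1, h2, RingHom.id_apply, smul_sum]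
        simp }
  else 0

theorem LocallyFinite.locSum_eventually {a : ℕ → Module.End ℂ M} (h : LocallyFinite a) (v : M) :
    ∀ᶠ K in atTop, locSum a v = ∑ j ∈ range K, a j v := by
  have : locSum a v = ∑ᶠ j, a j v := by
    rw [locSum, dif_pos h]
    rfl
  rw [this]
  exact h.eventually_sum v

/-- One truncation serves all the sums at once: it has to be large enough for `v` and also for the
two images `locSum b v` and `locSum a v`. -/
theorem LocallyFinite.comm_locSum {a b : ℕ → Module.End ℂ M} (ha : LocallyFinite a)
    (hb : LocallyFinite b) (v : M) : ∀ᶠ K in atTop,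
      (locSum a * locSum b - locSum b * locSum a) v =
        ∑ i ∈ range K, ∑ j ∈ range K, (a i * b j - b j * a i) v := by
  filter_upwards [ha.locSum_eventually v, hb.locSum_eventually v,
    ha.locSum_eventually (locSum b v), hb.locSum_eventually (locSum a v)] with K h1 h2 h3 h4
  rw [LinearMap.sub_apply, Module.End.mul_apply, Module.End.mul_apply, h3, h4, h1, h2]
  simp only [map_sum, LinearMap.sub_apply, Module.End.mul_apply, sum_sub_distrib]
  congr 1
  exact sum_comm

theorem LocallyFinite.commute_locSum {a b : ℕ → Module.End ℂ M} (ha : LocallyFinite a)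
    (hb : LocallyFinite b) (h : ∀ i j, Commute (a i) (b j)) : Commute (locSum a) (locSum b) := by
  rw [Commute, SemiconjBy, ← sub_eq_zero]
  ext v
  obtain ⟨K, hK⟩ := (ha.comm_locSum hb v).exists
  rw [hK, LinearMap.zero_apply]
  exact sum_eq_zero fun i _ => sum_eq_zero fun j _ => by rw [(h i j).eq]; simp

theorem LocallyFinite.comm_locSum_right {a : ℕ → Module.End ℂ M} (ha : LocallyFinite a)
    (D : Module.End ℂ M) (v : M) : ∀ᶠ K in atTop,
      (D * locSum a - locSum a * D) v = ∑ j ∈ range K, (D * a j - a j * D) v := by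
  filter_upwards [ha.locSum_eventually v, ha.locSum_eventually (D v)] with K h1 h2
  rw [LinearMap.sub_apply, Module.End.mul_apply, Module.End.mul_apply, h1, h2]
  simp only [map_sum, LinearMap.sub_apply, Module.End.mul_apply, sum_sub_distrib]

theorem LocallyFinite.commute_locSum_right {a : ℕ → Module.End ℂ M} (ha : LocallyFinite a)
    {D : Module.End ℂ M} (h : ∀ j, Commute D (a j)) : Commute D (locSum a) := by
  rw [Commute, SemiconjBy, ← sub_eq_zero]
  ext v
  obtain ⟨K, hK⟩ := (ha.comm_locSum_right D v).exists
  rw [hK, LinearMap.zero_apply]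
  exact sum_eq_zero fun j _ => by rw [(h j).eq]; simp

end LocallyFinite

/-! ### Coefficients of exponentials of a current -/

section ExpCoeff

variable {A : Type*} [Ring A] [Algebra ℂ A]

/-- The coefficients of `exp (β ∑_{n ≥ 1} τₙ zⁿ / n)`. -/
noncomputable def expCoeff (τ : ℕ → A) (β : ℂ) : ℕ → A
  | 0 => 1
  | n + 1 => (β / (n + 1)) • ∑ i : Fin (n + 1), τ (i + 1) * expCoeff τ β (n - i)

theorem expCoeff_zero (τ : ℕ → A) (β : ℂ) : expCoeff τ β 0 = 1 := by rw [expCoeff]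

theorem expCoeff_succ (τ : ℕ → A) (β : ℂ) (n : ℕ) : expCoeff τ β (n + 1) =
    (β / (n + 1)) • ∑ i ∈ range (n + 1), τ (i + 1) * expCoeff τ β (n - i) := by
  rw [expCoeff, Fin.sum_univ_eq_sum_range (fun i => τ (i + 1) * expCoeff τ β (n - i))]

theorem succ_smul_expCoeff_succ (τ : ℕ → A) (β : ℂ) (n : ℕ) :
    ((n : ℂ) + 1) • expCoeff τ β (n + 1) =
      β • ∑ i ∈ range (n + 1), τ (i + 1) * expCoeff τ β (n - i) := by
  rw [expCoeff_succ, smul_smul, mul_div_cancel₀ _ (Nat.cast_add_one_ne_zero n)]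

theorem commute_expCoeff {τ : ℕ → A} (β : ℂ) {x : A} (h : ∀ i, Commute x (τ i)) (n : ℕ) :
    Commute x (expCoeff τ β n) := by
  induction n using Nat.strong_induction_on with
  | _ n ih =>
    rcases n with _ | n
    · rw [expCoeff_zero]; exact Commute.one_right x
    · rw [expCoeff_succ]
      exact (Commute.sum_right _ _ _ fun i _ => (h _).mul_right (ih _ (by omega))).smul_right _

/-- The commutator with `D` is a derivation sending the exponent to the scalar series `β c zᵖ`;
hence it multiplies the exponential by that series. -/
theorem expCoeff_comm {τ : ℕ → A} (β c : ℂ) {D : A} {p : ℕ} (hp : 0 < p)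
    (h : ∀ i, D * τ i - τ i * D = if i = p then (c * p) • 1 else 0) (n : ℕ) :
    D * expCoeff τ β n - expCoeff τ β n * D =
      if p ≤ n then (β * c) • expCoeff τ β (n - p) else 0 := by
  induction n using Nat.strong_induction_on with
  | _ n ih =>
    rcases n with _ | n
    · rw [expCoeff_zero, if_neg (by omega)]; simp
    · have hn : ((n : ℂ) + 1) ≠ 0 := Nat.cast_add_one_ne_zero n
      have key : ∀ i ∈ range (n + 1),
          D * (τ (i + 1) * expCoeff τ β (n - i)) - τ (i + 1) * expCoeff τ β (n - i) * D =
          (if i + 1 = p then (c * p) • expCoeff τ β (n - i) else 0) +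
            (if p ≤ n - i then (β * c) • (τ (i + 1) * expCoeff τ β (n - i - p)) else 0) := by
        intro i hi
        have e : D * (τ (i + 1) * expCoeff τ β (n - i)) - τ (i + 1) * expCoeff τ β (n - i) * D =
          (D * τ (i + 1) - τ (i + 1) * D) * expCoeff τ β (n - i) +
            τ (i + 1) * (D * expCoeff τ β (n - i) - expCoeff τ β (n - i) * D) := by
          noncomm_ring
        rw [e, h, ih (n - i) (by omega)]
        congr 1
        · split_ifs <;> simp
        · split_ifs <;> simp
      have lhs : ((n : ℂ) + 1) • (D * expCoeff τ β (n + 1) - expCoeff τ β (n + 1) * D) =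
          β • ∑ i ∈ range (n + 1), (D * (τ (i + 1) * expCoeff τ β (n - i)) -
            τ (i + 1) * expCoeff τ β (n - i) * D) := by
        rw [smul_sub, ← mul_smul_comm, ← smul_mul_assoc, succ_smul_expCoeff_succ, mul_smul_comm,
          smul_mul_assoc, ← smul_sub, mul_sum, sum_mul, sum_sub_distrib]
      -- Multiplying by `n + 1` turns the claim into one about the recursion. The direct term, with
      -- factor `p`, and the recursion for index `n + 1 - p` add up to `n + 1`.
      rw [← smul_right_inj hn, lhs, sum_congr rfl key, sum_add_distrib]
      by_cases hpn : p ≤ n + 1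
      · obtain ⟨q, rfl⟩ : ∃ q, p = q + 1 := ⟨p - 1, by omega⟩
        have s1 : ∑ i ∈ range (n + 1), (if i + 1 = q + 1 then
            (c * ((q + 1 : ℕ) : ℂ)) • expCoeff τ β (n - i) else 0) =
            (c * ((q + 1 : ℕ) : ℂ)) • expCoeff τ β (n - q) := by
          rw [sum_eq_single q]
          · simp
          · intro b _ hb; rw [if_neg (by omega)]
          · intro hq; simp at hq; omega
        rw [s1, if_pos hpn]
        rcases Nat.lt_or_ge q n with hq | hq
        · obtain ⟨r, rfl⟩ : ∃ r, n = r + (q + 1) := ⟨n - (q + 1), by omega⟩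
          have s2 : ∑ i ∈ range (r + (q + 1) + 1), (if q + 1 ≤ r + (q + 1) - i then
              (β * c) • (τ (i + 1) * expCoeff τ β (r + (q + 1) - i - (q + 1))) else 0) =
              (β * c) • ∑ i ∈ range (r + 1), τ (i + 1) * expCoeff τ β (r - i) := by
            rw [smul_sum, ← sum_subset (range_mono (by omega : r + 1 ≤ r + (q + 1) + 1))]
            · refine sum_congr rfl fun i hi => ?_
              simp at hi
              rw [if_pos (by omega), show r + (q + 1) - i - (q + 1) = r - i by omega]
            · intro i _ hi
              simp at hi
              rw [if_neg (by omega)]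
          have s3 := succ_smul_expCoeff_succ τ β r
          rw [s2, show r + (q + 1) - q = r + 1 by omega,
            show r + (q + 1) + 1 - (q + 1) = r + 1 by omega, smul_add, smul_comm β (β * c), ← s3]
          push_cast
          module
        · obtain rfl : q = n := by omega
          rw [sum_eq_zero (f := fun i => if q + 1 ≤ q - i then _ else _)]
          · rw [show q + 1 - (q + 1) = q - q by omega]
            push_cast
            module
          · intro i _; rw [if_neg (by omega)]
      · rw [if_neg hpn, smul_zero, sum_eq_zero, sum_eq_zero, add_zero, smul_zero]
        · intro i _; rw [if_neg (by omega)]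
        · intro i hi; simp at hi; rw [if_neg (by omega)]

open PowerSeries in
-- With `E` the generating series, these say that `E(β) E(-β) = 1` and that `z E'(β) E(-β) = β ∑ₙ τₙ
-- zⁿ` with `n ≥ 1`. The first holds because the derivative of the product is zero; the second is
-- the differential equation of `E` multiplied by its inverse.
theorem expCoeff_mul_neg {τ : ℕ → A} (β : ℂ) (hτ : ∀ i j, Commute (τ i) (τ j)) (n : ℕ) :
    (∑ p ∈ antidiagonal n, expCoeff τ β p.1 * expCoeff τ (-β) p.2 = if n = 0 then 1 else 0) ∧
    (∑ p ∈ antidiagonal n, (p.1 : ℂ) • (expCoeff τ β p.1 * expCoeff τ (-β) p.2) =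
      if n = 0 then 0 else β • τ n) := by
  let U : PowerSeries A := PowerSeries.mk fun i => τ (i + 1)
  let E : ℂ → PowerSeries A := fun β => PowerSeries.mk (expCoeff τ β)
  let D : ℂ → PowerSeries A := fun β => PowerSeries.mk fun n => ((n : ℂ) + 1) • expCoeff τ β (n + 1)
  have hD : ∀ β, D β = β • (U * E β) := by
    intro β
    ext n
    rw [PowerSeries.coeff_smul, PowerSeries.coeff_mul, coeff_mk, succ_smul_expCoeff_succ,
      Nat.sum_antidiagonal_eq_sum_range_succ_mk]
    simp [U, E]
  have hUE : ∀ β, U * E β = E β * U := by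
    intro β
    ext n
    rw [PowerSeries.coeff_mul, PowerSeries.coeff_mul, ← Nat.sum_antidiagonal_swap]
    refine sum_congr rfl fun p _ => ?_
    simp only [U, E, coeff_mk, Prod.fst_swap, Prod.snd_swap]
    exact commute_expCoeff β (fun i => hτ _ _) _
  have hleft : ∀ n : ℕ, ∑ p ∈ antidiagonal (n + 1),
      (p.1 : ℂ) • (expCoeff τ β p.1 * expCoeff τ (-β) p.2) = coeff n (D β * E (-β)) := by
    intro n
    rw [Nat.sum_antidiagonal_succ, PowerSeries.coeff_mul]
    simp [D, E]
  have hright : ∀ n : ℕ, ∑ p ∈ antidiagonal (n + 1),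
      (p.2 : ℂ) • (expCoeff τ β p.1 * expCoeff τ (-β) p.2) = coeff n (E β * D (-β)) := by
    intro n
    rw [Nat.sum_antidiagonal_succ', PowerSeries.coeff_mul]
    simp [D, E]
  have h1 : ∀ n : ℕ, ∑ p ∈ antidiagonal n, expCoeff τ β p.1 * expCoeff τ (-β) p.2 =
      if n = 0 then 1 else 0 := by
    intro n
    rcases n with _ | n
    · simp [expCoeff_zero]
    · have hn : ((n : ℂ) + 1) ≠ 0 := Nat.cast_add_one_ne_zero n
      rw [← smul_right_inj hn, if_neg (by omega), smul_zero, smul_sum]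
      have : ∀ p ∈ antidiagonal (n + 1),
          ((n : ℂ) + 1) • (expCoeff τ β p.1 * expCoeff τ (-β) p.2) =
          (p.1 : ℂ) • (expCoeff τ β p.1 * expCoeff τ (-β) p.2) +
          (p.2 : ℂ) • (expCoeff τ β p.1 * expCoeff τ (-β) p.2) := by
        intro p hp
        rw [HasAntidiagonal.mem_antidiagonal] at hp
        rw [← add_smul]
        congr 1
        exact_mod_cast hp.symm
      rw [sum_congr rfl this, sum_add_distrib, hleft, hright, ← map_add, hD, hD, hUE,
        smul_mul_assoc, mul_smul_comm, neg_smul, mul_assoc, add_neg_cancel, map_zero]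
  refine ⟨h1 n, ?_⟩
  rcases n with _ | n
  · simp
  · have hE : E β * E (-β) = 1 := by
      ext n
      rw [PowerSeries.coeff_mul, PowerSeries.coeff_one, ← h1]
      simp [E]
    rw [hleft, hD, smul_mul_assoc, mul_assoc, hE, mul_one, PowerSeries.coeff_smul]
    simp [U]

end ExpCoeff

section ExpCoeffModule

variable {M : Type*} [AddCommGroup M] [Module ℂ M]

theorem expCoeff_mem {τ : ℕ → Module.End ℂ M} (β : ℂ) (Fil : ℤ → Submodule ℂ M)
    (h : ∀ (i : ℕ) (d : ℤ), ∀ v ∈ Fil d, τ (i + 1) v ∈ Fil (d - (i + 1))) (n : ℕ) :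
    ∀ d, ∀ v ∈ Fil d, expCoeff τ β n v ∈ Fil (d - n) := by
  induction n using Nat.strong_induction_on with
  | _ n ih =>
    intro d v hv
    rcases n with _ | n
    · rw [expCoeff_zero]; simpa using hv
    · rw [expCoeff_succ, LinearMap.smul_apply, LinearMap.sum_apply]
      refine Submodule.smul_mem _ _ (Submodule.sum_mem _ fun i hi => ?_)
      rw [Finset.mem_range] at hi
      have := h i _ _ (ih (n - i) (by omega) d v hv)
      have e : d - ((n - i : ℕ) : ℤ) - (i + 1) = d - ((n + 1 : ℕ) : ℤ) := by omega
      rwa [e] at this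

/-- Taking adjoints reverses the products in the recursion, which is why the `τ'` must commute. The
sign in the adjoint of `τ` joins the conjugate of `β`. -/
theorem expCoeff_adjoint {τ τ' : ℕ → Module.End ℂ M} (β : ℂ) (C : M →ₗ⋆[ℂ] M →ₗ[ℂ] ℂ)
    (hτ : ∀ i j, Commute (τ' i) (τ' j))
    (h : ∀ i x y, C (τ i x) y = -C x (τ' i y)) (n : ℕ) : ∀ x y,
    C (expCoeff τ β n x) y = C x (expCoeff τ' (-starRingEnd ℂ β) n y) := by
  induction n using Nat.strong_induction_on with
  | _ n ih =>
    intro x y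
    rcases n with _ | n
    · simp [expCoeff_zero]
    · rw [expCoeff_succ, expCoeff_succ]
      simp only [LinearMap.smul_apply, LinearMap.sum_apply, map_sum, LinearMap.map_smulₛₗ,
        map_smul, Module.End.mul_apply, smul_eq_mul, map_div₀, map_add, map_one, map_natCast]
      rw [neg_div, neg_mul, ← mul_neg, ← sum_neg_distrib]
      congr 1
      refine sum_congr rfl fun i hi => ?_
      rw [h, ih _ (by omega), ← Module.End.mul_apply, ← Module.End.mul_apply,
        (commute_expCoeff _ (fun j => hτ _ _) _).eq]

end ExpCoeffModule

end NappiWitten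

namespace NappiWitten

open Filter Finset

/-! ### Products of a field with a series of operators -/

section Dressing

variable {M : Type*} [AddCommGroup M] [Module ℂ M] {ε : ℤ} {e f : ℕ → Module.End ℂ M}
  {Q R : ℤ → Module.End ℂ M}

/-- The modes of the product of the field `∑ₙ Qₙ z⁻ⁿ` with the series `∑ⱼ eⱼ z^{-εj}`. -/
noncomputable def dress (ε : ℤ) (e : ℕ → Module.End ℂ M) (Q : ℤ → Module.End ℂ M) (m : ℤ) :
    Module.End ℂ M :=
  locSum fun j => e j * Q (m - ε * j)

/-- The product of a field and a series is well defined. -/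
def Dressable (ε : ℤ) (e : ℕ → Module.End ℂ M) (Q : ℤ → Module.End ℂ M) : Prop :=
  ∀ m, LocallyFinite fun j => e j * Q (m - ε * j)

theorem Dressable.commute (h : Dressable ε e Q) {D : Module.End ℂ M}
    (he : ∀ j, Commute D (e j)) (hQ : ∀ n, Commute D (Q n)) (m : ℤ) :
    Commute D (dress ε e Q m) :=
  (h m).commute_locSum_right fun j => (he j).mul_right (hQ _)

theorem Dressable.commute_dress (h : Dressable ε e Q) (h' : Dressable ε f R)
    (hef : ∀ i j, Commute (e i) (f j)) (heR : ∀ i n, Commute (e i) (R n))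
    (hfQ : ∀ i n, Commute (f i) (Q n)) (hQR : ∀ m n, Commute (Q m) (R n)) (m n : ℤ) :
    Commute (dress ε e Q m) (dress ε f R n) :=
  (h m).commute_locSum (h' n) fun i j =>
    ((hef i j).mul_right (heR i _)).mul_left ((hfQ j _).symm.mul_right (hQR _ _))

theorem Dressable.comm_of_commute_coeff (h : Dressable ε e Q) {D : Module.End ℂ M} {m : ℤ} {c : ℂ}
    (he : ∀ j, Commute D (e j)) (hQ : ∀ n, D * Q n - Q n * D = c • Q (m + n)) (n : ℤ) :
    D * dress ε e Q n - dress ε e Q n * D = c • dress ε e Q (m + n) := by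
  ext v
  obtain ⟨K, h1, h2⟩ := (((h n).comm_locSum_right D v).and
    ((h (m + n)).locSum_eventually v)).exists
  rw [LinearMap.smul_apply, dress, dress, h1, h2, smul_sum]
  refine sum_congr rfl fun j _ => ?_
  rw [← LinearMap.smul_apply]
  congr 1
  rw [← mul_assoc, (he j).eq, mul_assoc, mul_assoc, ← mul_sub, hQ, mul_smul_comm, add_sub_assoc]

theorem Dressable.comm_of_commute_field (h : Dressable ε e Q) {D : Module.End ℂ M} {p : ℕ} {c : ℂ}
    (he : ∀ j, D * e j - e j * D = if p ≤ j then c • e (j - p) else 0)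
    (hQ : ∀ n, Commute D (Q n)) (n : ℤ) :
    D * dress ε e Q n - dress ε e Q n * D = c • dress ε e Q (n - ε * p) := by
  ext v
  -- The truncation is taken at `K + p` on one side: the first `p` terms vanish and the others are
  -- the truncation at `K` of the shifted sum.
  obtain ⟨K, h1, h2⟩ := (((tendsto_add_atTop_nat p).eventually
    ((h n).comm_locSum_right D v)).and ((h (n - ε * p)).locSum_eventually v)).exists
  rw [LinearMap.smul_apply, dress, dress, h1, h2, smul_sum, add_comm K p, sum_range_add]
  have key : ∀ j, D * (e j * Q (n - ε * j)) - e j * Q (n - ε * j) * D =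
      (if p ≤ j then c • e (j - p) else 0) * Q (n - ε * j) := by
    intro j
    rw [← he, sub_mul, mul_assoc, mul_assoc, mul_assoc, (hQ _).eq]
  rw [sum_eq_zero, zero_add]
  · refine sum_congr rfl fun j _ => ?_
    rw [key, if_pos (by omega), ← LinearMap.smul_apply, smul_mul_assoc, Nat.add_sub_cancel_left]
    congr 4
    push_cast
    ring
  · intro j hj
    rw [Finset.mem_range] at hj
    rw [key, if_neg (by omega)]
    simp

theorem sum_range_range_eq_sum_antidiagonal {N : Type*} [AddCommMonoid N] (g : ℕ → ℕ → N) (K : ℕ)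
    (hg : ∀ i j, K ≤ i + j → g i j = 0) :
    ∑ i ∈ range K, ∑ j ∈ range K, g i j = ∑ l ∈ range K, ∑ p ∈ antidiagonal l, g p.1 p.2 := by
  simp_rw [Nat.sum_antidiagonal_eq_sum_range_succ g]
  rw [sum_range_diag_flip]
  refine sum_congr rfl fun i _ => (sum_subset (range_mono (by omega)) fun j _ hj => ?_).symm
  exact hg i j (by simp at hj; omega)

/-- The exponentials can be pulled out, leaving `E i * F j` times the commutator of the shifted
modes. Summed over `i + j = l`, the product identity for `E` and `F` leaves only `l = 0`, except
that the central term carries the factor `m - ε i`; its part linear in `i` produces `τ l` by the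
logarithmic derivative identity. The condition `hfin` makes the regrouped double sum finite. -/
theorem dress_comm_dress {τ : ℕ → Module.End ℂ M} {β κ : ℂ} {Θ : ℤ → Module.End ℂ M}
    (hε : ε = 1 ∨ ε = -1)
    (h : Dressable ε (expCoeff τ β) Q) (h' : Dressable ε (expCoeff τ (-β)) R)
    (hτ : ∀ i j, Commute (τ i) (τ j)) (hQ : ∀ i n, Commute (τ i) (Q n))
    (hR : ∀ i n, Commute (τ i) (R n))
    (hQR : ∀ m n, Q m * R n - R n * Q m = Θ (m + n) + (if m + n = 0 then (κ * m) • 1 else 0))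
    (hfin : ∀ N v, ∃ L : ℕ, ∀ i j, L ≤ i + j →
      (expCoeff τ β i * expCoeff τ (-β) j * Θ (N - ε * (i + j : ℕ))) v = 0) (m n : ℤ) :
    dress ε (expCoeff τ β) Q m * dress ε (expCoeff τ (-β)) R n -
      dress ε (expCoeff τ (-β)) R n * dress ε (expCoeff τ β) Q m =
    Θ (m + n) + (if 0 < ε * (m + n) then -(κ * ε * β) • τ (ε * (m + n)).toNat else 0) +
      (if m + n = 0 then (κ * m) • 1 else 0) := by
  have hε2 : ε * ε = 1 := by rcases hε with rfl | rfl <;> norm_num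
  have ceτ : ∀ γ δ i j, Commute (expCoeff τ γ i) (expCoeff τ δ j) := fun γ δ i j =>
    commute_expCoeff δ (fun l => (commute_expCoeff γ (fun l' => hτ l l') i).symm) j
  have ceQ : ∀ γ i n, Commute (expCoeff τ γ i) (Q n) := fun γ i n =>
    (commute_expCoeff γ (fun l => (hQ l n).symm) i).symm
  have ceR : ∀ γ i n, Commute (expCoeff τ γ i) (R n) := fun γ i n =>
    (commute_expCoeff γ (fun l => (hR l n).symm) i).symm
  set E := expCoeff τ β with hE
  set F := expCoeff τ (-β) with hF
  have term : ∀ i j : ℕ, E i * Q (m - ε * i) * (F j * R (n - ε * j)) -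
      F j * R (n - ε * j) * (E i * Q (m - ε * i)) =
      E i * F j * Θ (m + n - ε * (i + j : ℕ)) +
        (if m + n = ε * (i + j : ℕ) then (κ * (m - ε * i)) • (E i * F j) else 0) := by
    intro i j
    have e1 : E i * Q (m - ε * i) * (F j * R (n - ε * j)) =
        E i * F j * (Q (m - ε * i) * R (n - ε * j)) := by
      rw [mul_assoc, ← mul_assoc (Q _), ← (ceQ _ j _).eq]
      simp only [mul_assoc]
      rfl
    have e2 : F j * R (n - ε * j) * (E i * Q (m - ε * i)) =
        E i * F j * (R (n - ε * j) * Q (m - ε * i)) := by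
      rw [mul_assoc, ← mul_assoc (R _), ← (ceR _ i _).eq, (ceτ β (-β) i j).eq]
      simp only [mul_assoc]
      rfl
    rw [e1, e2, ← mul_sub, hQR, mul_add,
      show m - ε * i + (n - ε * j) = m + n - ε * (i + j : ℕ) by push_cast; ring]
    congr 1
    simp only [sub_eq_zero]
    split_ifs
    · push_cast; rw [mul_smul_comm, mul_one]
    · simp
  ext v
  obtain ⟨L, hL⟩ := hfin (m + n) v
  obtain ⟨K, h1, hKL, hKN⟩ := (((h m).comm_locSum (h' n) v).and ((eventually_ge_atTop L).and
    (eventually_ge_atTop ((m + n).natAbs + 1)))).exists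
  have abs_of : ∀ l : ℕ, m + n = ε * l → l = (m + n).natAbs := by
    intro l hl
    rcases hε with rfl | rfl <;> omega
  -- The square of indices may be replaced by a triangle because all terms with `i + j ≥ K` vanish:
  -- those with `Θ` by `hfin`, the central ones since `K` exceeds `|m + n|`.
  rw [dress, dress, h1, sum_range_range_eq_sum_antidiagonal]
  swap
  · intro i j hij
    rw [term, LinearMap.add_apply, hL i j (by omega), if_neg fun hh => ?_]
    · simp
    · have := abs_of _ hh
      omega
  have inner : ∀ l : ℕ, ∑ p ∈ antidiagonal l,
      (E p.1 * Q (m - ε * p.1) * (F p.2 * R (n - ε * p.2)) -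
        F p.2 * R (n - ε * p.2) * (E p.1 * Q (m - ε * p.1))) v =
      if l = 0 then (Θ (m + n) + (if m + n = 0 then (κ * m) • 1 else 0)) v
      else (if m + n = ε * l then -(κ * ε * β) • τ l else 0) v := by
    intro l
    obtain ⟨g1, g2⟩ := expCoeff_mul_neg β hτ l
    rw [← hE, ← hF] at g1 g2
    rw [← LinearMap.sum_apply]
    have : ∑ p ∈ antidiagonal l,
      (E p.1 * Q (m - ε * p.1) * (F p.2 * R (n - ε * p.2)) -
        F p.2 * R (n - ε * p.2) * (E p.1 * Q (m - ε * p.1))) =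
      (∑ p ∈ antidiagonal l, E p.1 * F p.2) * Θ (m + n - ε * l) +
      (if m + n = ε * l then (κ * m) • (∑ p ∈ antidiagonal l, E p.1 * F p.2) -
        (κ * ε) • ∑ p ∈ antidiagonal l, (p.1 : ℂ) • (E p.1 * F p.2) else 0) := by
      rw [sum_mul]
      have hp : ∀ p ∈ antidiagonal l, (E p.1 * Q (m - ε * p.1) * (F p.2 * R (n - ε * p.2)) -
        F p.2 * R (n - ε * p.2) * (E p.1 * Q (m - ε * p.1))) =
          E p.1 * F p.2 * Θ (m + n - ε * l) + (if m + n = ε * l then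
            (κ * m) • (E p.1 * F p.2) - (κ * ε) • (p.1 : ℂ) • (E p.1 * F p.2) else 0) := by
        intro p hp
        rw [HasAntidiagonal.mem_antidiagonal] at hp
        rw [term, hp]
        congr 1
        split_ifs
        · module
        · rfl
      rw [sum_congr rfl hp, sum_add_distrib]
      congr 1
      split_ifs
      · rw [sum_sub_distrib, smul_sum, smul_sum]
      · simp
    rw [this, g1, g2]
    rcases Nat.eq_zero_or_pos l with rfl | hl
    · simp
    · rw [if_neg hl.ne', if_neg hl.ne', if_neg hl.ne']
      congr 1
      split_ifs
      · rw [zero_mul, smul_zero, zero_add, zero_sub, smul_smul, neg_smul]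
      · simp
  rw [sum_congr rfl fun l _ => inner l]
  obtain ⟨K, rfl⟩ : ∃ K', K = K' + 1 := ⟨K - 1, by omega⟩
  -- The term `l = 0` is the undressed commutator; among the others only `l = ε (m + n)`
  -- contributes.
  rw [sum_range_succ', if_pos rfl]
  simp only [Nat.add_eq_zero_iff, one_ne_zero, and_false, if_false]
  rw [add_right_comm, LinearMap.add_apply _ (ite _ _ _), add_comm]
  congr 1
  by_cases hN : 0 < ε * (m + n)
  · rw [if_pos hN, sum_eq_single ((ε * (m + n)).toNat - 1)]
    · rw [Nat.sub_add_cancel (by omega), if_pos]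
      rw [Int.toNat_of_nonneg hN.le, ← mul_assoc, hε2, one_mul]
    · intro l _ hl
      rw [if_neg, LinearMap.zero_apply]
      intro hh
      apply hl
      rw [hh, ← mul_assoc, hε2, one_mul]
      simp
    · intro hl
      exfalso
      apply hl
      rw [Finset.mem_range]
      rcases hε with rfl | rfl <;> omega
  · rw [if_neg hN, sum_eq_zero, LinearMap.zero_apply]
    intro l _
    rw [if_neg, LinearMap.zero_apply]
    intro hh
    apply hN
    rw [hh, ← mul_assoc, hε2, one_mul]
    positivity

end Dressing

end NappiWitten

namespace NappiWitten

open Filter Finset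

/-! ### Charged fields dressed by exponentials of the null current -/

section VertexField

variable {M : Type*} [AddCommGroup M] [Module ℂ M] {k : ℝ} {J T : ℤ → Module.End ℂ M}

/-- The currents `J`, `T` commute like the two Cartan currents of the affine algebra, and
exponentials of the positive modes of `T` are well defined. -/
structure CartanCurrents (k : ℝ) (J T : ℤ → Module.End ℂ M) : Prop where
  J_T : ∀ m n, J m * T n - T n * J m = if m + n = 0 then ((k / 2 : ℂ) * m) • 1 else 0
  T_T : ∀ m n, Commute (T m) (T n)
  T_fin : ∀ β, LocallyFinite (expCoeff (fun l : ℕ => T l) β)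

/-- A field with charge `η` under the zero mode of `J`, commuting with all other modes of the
currents `J` and `T`. -/
structure ChargedField (J T : ℤ → Module.End ℂ M) (η : ℂ) (P : ℤ → Module.End ℂ M) : Prop where
  T_P : ∀ m n, Commute (T m) (P n)
  J_zero_P : ∀ n, J 0 * P n - P n * J 0 = (η * Complex.I) • P n
  J_P : ∀ m n, m ≠ 0 → Commute (J m) (P n)
  P_fin : ∀ v, ∃ N : ℤ, ∀ n, N ≤ n → P n v = 0

/-- The field `P` multiplied by the exponential of the negative modes of `T`. -/
noncomputable def halfVertex (k : ℝ) (T : ℤ → Module.End ℂ M) (η : ℂ) (P : ℤ → Module.End ℂ M) :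
    ℤ → Module.End ℂ M :=
  dress (-1) (expCoeff (fun l : ℕ => T (-l)) (η * (2 * Complex.I / k))) P

/-- The field `P` multiplied by the normally ordered exponential of the nonzero modes of `T`. -/
noncomputable def vertexField (k : ℝ) (T : ℤ → Module.End ℂ M) (η : ℂ) (P : ℤ → Module.End ℂ M) :
    ℤ → Module.End ℂ M :=
  dress 1 (expCoeff (fun l : ℕ => T l) (-(η * (2 * Complex.I / k)))) (halfVertex k T η P)

variable {η η' : ℂ} {P P' : ℤ → Module.End ℂ M}

namespace ChargedField

theorem dressable_half (hP : ChargedField J T η P) (e : ℕ → Module.End ℂ M) :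
    Dressable (-1) e P := by
  intro m v
  obtain ⟨N, hN⟩ := hP.P_fin v
  filter_upwards [eventually_ge_atTop (N - m).toNat] with j hj
  rw [Module.End.mul_apply, hN _ (by omega), map_zero]

theorem T_half (hC : CartanCurrents k J T) (hP : ChargedField J T η P) (m n : ℤ) :
    Commute (T m) (halfVertex k T η P n) :=
  (hP.dressable_half _).commute (commute_expCoeff _ fun _ => hC.T_T _ _) (hP.T_P m) n

/-- The modes of the half dressed field move towards `-∞` and need not vanish on a vector.
Finiteness comes instead from moving the coefficient, which commutes with them, to act first. -/
theorem dressable (hC : CartanCurrents k J T) (hP : ChargedField J T η P) (β : ℂ) :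
    Dressable 1 (expCoeff (fun l : ℕ => T l) β) (halfVertex k T η P) := by
  intro m v
  filter_upwards [hC.T_fin β v] with j hj
  rw [← (commute_expCoeff β (fun l => (hP.T_half hC l _).symm) j).eq, Module.End.mul_apply, hj,
    map_zero]

theorem T_vertex (hC : CartanCurrents k J T) (hP : ChargedField J T η P) (m n : ℤ) :
    Commute (T m) (vertexField k T η P n) :=
  (hP.dressable hC _).commute (commute_expCoeff _ fun _ => hC.T_T _ _) (hP.T_half hC m) n

theorem _root_.NappiWitten.CartanCurrents.commute_J_T (hC : CartanCurrents k J T) {m n : ℤ}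
    (h : m + n ≠ 0 ∨ m = 0) : Commute (J m) (T n) := by
  rw [Commute, SemiconjBy, ← sub_eq_zero, hC.J_T]
  rcases h with h | rfl
  · rw [if_neg h]
  · simp

/-- For `m = 0` the charge of `P` is responsible. For `m > 0` it is the mode `T (-m)` in the
exponential, whose commutator `k m / 2` with `J m` cancels the `2 / k` in the exponent and leaves `η
i`. -/
theorem J_half (hk : k ≠ 0) (hC : CartanCurrents k J T) (hP : ChargedField J T η P) {m : ℤ}
    (hm : 0 ≤ m) (n : ℤ) :
    J m * halfVertex k T η P n - halfVertex k T η P n * J m =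
      (η * Complex.I) • halfVertex k T η P (m + n) := by
  have hk' : (k : ℂ) ≠ 0 := by exact_mod_cast hk
  rcases hm.eq_or_lt with rfl | hm
  · refine (hP.dressable_half _).comm_of_commute_coeff
      (commute_expCoeff _ fun l => hC.commute_J_T (.inr rfl)) (fun n => ?_) n
    rw [hP.J_zero_P, zero_add]
  · obtain ⟨p, rfl⟩ := Int.eq_ofNat_of_zero_le hm.le
    have key := (hP.dressable_half
      (expCoeff (fun l : ℕ => T (-l)) (η * (2 * Complex.I / k)))).comm_of_commute_field
      (D := J p) (p := p) (c := η * Complex.I) (fun j => ?_) (fun n => hP.J_P _ _ hm.ne') n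
    · rw [halfVertex, key]
      congr 2
      ring
    · rw [expCoeff_comm _ (k / 2) (p := p) (by omega)]
      · congr 2
        field_simp
      · intro i
        rw [hC.J_T]
        by_cases hi : i = p
        · subst hi; simp
        · rw [if_neg (by omega), if_neg hi]

theorem commute_J_half (hC : CartanCurrents k J T) (hP : ChargedField J T η P) {m : ℤ}
    (hm : m < 0) (n : ℤ) : Commute (J m) (halfVertex k T η P n) :=
  (hP.dressable_half _).commute
    (commute_expCoeff _ fun l => hC.commute_J_T (.inl (by omega))) (fun n => hP.J_P m n hm.ne) n

theorem J_vertex (hk : k ≠ 0) (hC : CartanCurrents k J T) (hP : ChargedField J T η P) (m n : ℤ) :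
    J m * vertexField k T η P n - vertexField k T η P n * J m =
      (η * Complex.I) • vertexField k T η P (m + n) := by
  have hk' : (k : ℂ) ≠ 0 := by exact_mod_cast hk
  rcases le_or_gt 0 m with hm | hm
  · refine (hP.dressable hC _).comm_of_commute_coeff
      (commute_expCoeff _ fun l => hC.commute_J_T ?_) (fun n => hP.J_half hk hC hm n) n
    rcases hm.eq_or_lt with rfl | hm
    · exact .inr rfl
    · exact .inl (by omega)
  · obtain ⟨p, rfl⟩ : ∃ p : ℕ, m = -p := ⟨m.natAbs, by omega⟩
    have key := (hP.dressable hC (-(η * (2 * Complex.I / k)))).comm_of_commute_field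
      (D := J (-p)) (p := p) (c := η * Complex.I) (fun j => ?_)
      (fun n => hP.commute_J_half hC hm n) n
    · rw [vertexField, key]
      congr 2
      ring
    · rw [expCoeff_comm _ (-(k / 2)) (p := p) (by omega)]
      · congr 2
        field_simp
      · intro i
        rw [hC.J_T]
        by_cases hi : i = p
        · subst hi; simp
        · rw [if_neg (by omega), if_neg hi]

theorem commute_T_expCoeff (hP : ChargedField J T η P)
    {ι : ℕ → ℤ} (β : ℂ) (i : ℕ) (n : ℤ) :
    Commute (expCoeff (fun l => T (ι l)) β i) (P n) :=
  (commute_expCoeff _ (fun _ => (hP.T_P _ _).symm) i).symm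

theorem _root_.NappiWitten.CartanCurrents.commute_expCoeff (hC : CartanCurrents k J T)
    {ι ι' : ℕ → ℤ} (β β' : ℂ) (i j : ℕ) :
    Commute (expCoeff (fun l => T (ι l)) β i) (expCoeff (fun l => T (ι' l)) β' j) :=
  NappiWitten.commute_expCoeff _
    (fun _ => (NappiWitten.commute_expCoeff _ (fun _ => hC.T_T _ _) i).symm) j

theorem commute_vertex (hC : CartanCurrents k J T) (hP : ChargedField J T η P)
    (hP' : ChargedField J T η' P') (h : ∀ m n, Commute (P m) (P' n)) (m n : ℤ) :
    Commute (vertexField k T η P m) (vertexField k T η' P' n) := by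
  refine (hP.dressable hC _).commute_dress (hP'.dressable hC _) (hC.commute_expCoeff _ _)
    (fun i n => (commute_expCoeff _ (fun _ => (hP'.T_half hC _ _).symm) i).symm)
    (fun i n => (commute_expCoeff _ (fun _ => (hP.T_half hC _ _).symm) i).symm) ?_ m n
  exact (hP.dressable_half _).commute_dress (hP'.dressable_half _) (hC.commute_expCoeff _ _)
    (hP'.commute_T_expCoeff _) (hP.commute_T_expCoeff _) h

/-- `T 0` is already in the commutator of the undressed fields. The negative exponential adds the `T
N` with `N < 0`, the positive one those with `N > 0`; the exponents `±2i/k` are chosen so that both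
appear with coefficient `2i`. -/
theorem vertex_comm (hk : k ≠ 0) (hC : CartanCurrents k J T) (hP : ChargedField J T 1 P)
    (hP' : ChargedField J T (-1) P')
    (h : ∀ m n, P m * P' n - P' n * P m =
      if m + n = 0 then (2 * Complex.I) • T 0 + ((k : ℂ) * m) • 1 else 0) (m n : ℤ) :
    vertexField k T 1 P m * vertexField k T (-1) P' n -
      vertexField k T (-1) P' n * vertexField k T 1 P m =
      (2 * Complex.I) • T (m + n) + (if m + n = 0 then ((k : ℂ) * m) • 1 else 0) := by
  have hk' : (k : ℂ) ≠ 0 := by exact_mod_cast hk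
  have half : ∀ m n, halfVertex k T 1 P m * halfVertex k T (-1) P' n -
      halfVertex k T (-1) P' n * halfVertex k T 1 P m =
      (if m + n ≤ 0 then (2 * Complex.I) • T (m + n) else 0) +
        (if m + n = 0 then ((k : ℂ) * m) • 1 else 0) := by
    intro m n
    have key := dress_comm_dress (ε := -1) (κ := k) (β := 1 * (2 * Complex.I / k))
      (τ := fun l : ℕ => T (-l)) (Q := P) (R := P')
      (Θ := fun N => if N = 0 then (2 * Complex.I) • T 0 else 0) (.inr rfl)
      (hP.dressable_half _) (hP'.dressable_half _) (fun _ _ => hC.T_T _ _)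
      (fun _ _ => hP.T_P _ _) (fun _ _ => hP'.T_P _ _) (fun m n => ?_) (fun N v => ?_) m n
    · rw [halfVertex, halfVertex, show (-1 : ℂ) * (2 * Complex.I / k) =
        -(1 * (2 * Complex.I / k)) by ring, key]
      congr 1
      rcases lt_trichotomy (m + n) 0 with hN | hN | hN
      · rw [if_neg hN.ne, if_pos (by omega), if_pos (by omega), zero_add,
          Int.toNat_of_nonneg (by omega)]
        congr 2
        · push_cast; field_simp
        · ring
      · simp [hN]
      · rw [if_neg hN.ne', if_neg (by omega), if_neg (by omega), zero_add]
    · rw [h]; split_ifs <;> simp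
    · refine ⟨N.natAbs + 1, fun i j hij => ?_⟩
      rw [if_neg (by omega), mul_zero, LinearMap.zero_apply]
  have key := dress_comm_dress (ε := 1) (κ := k) (β := -(1 * (2 * Complex.I / k)))
      (τ := fun l : ℕ => T l) (Q := halfVertex k T 1 P) (R := halfVertex k T (-1) P')
      (Θ := fun N => if N ≤ 0 then (2 * Complex.I) • T N else 0) (.inl rfl)
      (hP.dressable hC _) (hP'.dressable hC _) (fun _ _ => hC.T_T _ _)
      (fun _ _ => hP.T_half hC _ _) (fun _ _ => hP'.T_half hC _ _) half (fun N v => ?_) m n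
  · rw [vertexField, vertexField, show -((-1 : ℂ) * (2 * Complex.I / k)) =
        - -(1 * (2 * Complex.I / k)) by ring, key]
    congr 1
    rcases le_or_gt (m + n) 0 with hN | hN
    · rw [if_pos hN, if_neg (by omega), add_zero]
    · rw [if_neg (by omega), if_pos (by omega), zero_add, Int.toNat_of_nonneg (by omega), one_mul]
      congr 1
      · push_cast; field_simp
      · rw [one_mul]
  · set β := -(1 * (2 * Complex.I / (k : ℂ)))
    obtain ⟨L, h1⟩ := eventually_atTop.1 (hC.T_fin β v)
    obtain ⟨L', h2⟩ := eventually_atTop.1 (hC.T_fin (-β) v)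
    refine ⟨L + L', fun i j hij => ?_⟩
    have hΘ : ∀ γ l, Commute (expCoeff (fun l : ℕ => T l) γ l)
        (if N - 1 * (i + j : ℕ) ≤ 0 then (2 * Complex.I) • T (N - 1 * (i + j : ℕ)) else 0) := by
      intro γ l
      split_ifs
      · exact (commute_expCoeff γ (fun _ => (hC.T_T _ _).smul_left _) l).symm
      · exact Commute.zero_right _
    -- One of the two indices is past its bound, and all coefficients commute with `T`, so the
    -- corresponding one can be made to act on `v` first.
    rcases le_or_gt L i with hi | hi
    · rw [(hC.commute_expCoeff (ι := fun l => l) (ι' := fun l => l) β (-β) i j).eq, mul_assoc,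
        (hΘ β i).eq]
      simp only [Module.End.mul_apply, h1 i hi, map_zero]
    · rw [mul_assoc, (hΘ (-β) j).eq]
      simp only [Module.End.mul_apply, h2 j (by omega), map_zero]

theorem vertex_apply_eventually (hC : CartanCurrents k J T) (hP : ChargedField J T η P) (n : ℤ)
    (v : M) : ∀ᶠ K : ℕ in atTop, vertexField k T η P n v = ∑ j ∈ range K, ∑ i ∈ range K,
      expCoeff (fun l : ℕ => T l) (-(η * (2 * Complex.I / k))) j
        (expCoeff (fun l : ℕ => T (-l)) (η * (2 * Complex.I / k)) i (P (n - j + i) v)) := by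
  set E := expCoeff (fun l : ℕ => T l) (-(η * (2 * Complex.I / k))) with hE
  set F := expCoeff (fun l : ℕ => T (-l)) (η * (2 * Complex.I / k)) with hF
  obtain ⟨L, hL⟩ := eventually_atTop.1 (hC.T_fin (-(η * (2 * Complex.I / k))) v)
  have hLP : ∀ j i m, L ≤ j → E j (F i (P m v)) = 0 := by
    intro j i m hj
    have e : E j * (F i * P m) = (F i * P m) * E j :=
      ((hC.commute_expCoeff (ι := fun l => l) (ι' := fun l => -l) _ _ j i).mul_right
        (hP.commute_T_expCoeff (ι := fun l => l) _ j m)).eq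
    have := LinearMap.congr_fun e v
    simp only [Module.End.mul_apply] at this
    rw [this, hL j hj, map_zero, map_zero]
  obtain ⟨K₀, hK₀, hLK₀⟩ := (((hP.dressable hC (-(η * (2 * Complex.I / k))) n).locSum_eventually
    v).and (eventually_ge_atTop L)).exists
  have hev : ∀ᶠ K in atTop, ∀ j ∈ range K₀, halfVertex k T η P (n - 1 * j) v =
      ∑ i ∈ range K, (F i * P (n - 1 * j - (-1) * i)) v := by
    rw [Finset.eventually_all]
    intro j _
    exact (hP.dressable_half _ (n - 1 * j)).locSum_eventually v
  filter_upwards [hev, eventually_ge_atTop K₀] with K hK hKK₀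
  rw [vertexField, dress, hK₀, ← sum_subset (range_mono hKK₀)]
  · refine sum_congr rfl fun j hj => ?_
    rw [Module.End.mul_apply, hK j hj, map_sum]
    refine sum_congr rfl fun i _ => ?_
    rw [Module.End.mul_apply, show n - 1 * j - (-1) * i = n - j + i by ring]
  · intro j _ hj
    rw [Finset.mem_range] at hj
    exact sum_eq_zero fun i _ => hLP j i _ (by omega)

/-- On fixed vectors both fields are finite double sums with a common truncation, so adjoints can be
taken term by term; the adjoint exchanges the positive and the negative exponential. -/
theorem vertex_adjoint (hC : CartanCurrents k J T) (hP : ChargedField J T 1 P)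
    (hP' : ChargedField J T (-1) P') (C : M →ₗ⋆[ℂ] M →ₗ[ℂ] ℂ)
    (hT : ∀ n x y, C (T n x) y = -C x (T (-n) y))
    (h : ∀ n x y, C (P n x) y = -C x (P' (-n) y)) (n : ℤ) (x y : M) :
    C (vertexField k T 1 P n x) y = -C x (vertexField k T (-1) P' (-n) y) := by
  obtain ⟨K, h1, h2⟩ := ((hP.vertex_apply_eventually hC n x).and
    (hP'.vertex_apply_eventually hC (-n) y)).exists
  rw [h1, h2]
  simp only [map_sum, LinearMap.sum_apply]
  rw [sum_comm, ← sum_neg_distrib]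
  refine sum_congr rfl fun i _ => ?_
  rw [← sum_neg_distrib]
  refine sum_congr rfl fun j _ => ?_
  have a1 := expCoeff_adjoint (τ := fun l : ℕ => T l) (τ' := fun l : ℕ => T (-l))
    (-(1 * (2 * Complex.I / k))) C (fun _ _ => hC.T_T _ _) (fun l => hT l) j
  have a2 := expCoeff_adjoint (τ := fun l : ℕ => T (-l)) (τ' := fun l : ℕ => T l)
    (1 * (2 * Complex.I / k)) C (fun _ _ => hC.T_T _ _) (fun l x y => by simpa using hT (-l) x y) i
  -- The exponent is purely imaginary, so passing to the adjoint turns the coefficient for charge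
  -- `1` into that for charge `-1`.
  have b1 : -starRingEnd ℂ (-(1 * (2 * Complex.I / k))) = (-1) * (2 * Complex.I / k) := by
    simp [map_ofNat]
    ring
  have b2 : -starRingEnd ℂ (1 * (2 * Complex.I / k)) = -((-1) * (2 * Complex.I / k)) := by
    simp [map_ofNat]
    ring
  rw [a1, a2, h, b1, b2]
  congr 2
  have e := ((hP'.commute_T_expCoeff (ι := fun l => l) (-((-1) * (2 * Complex.I / k))) i
    (-(n - j + i))).symm.mul_right (hP'.commute_T_expCoeff (ι := fun l => -l)
      ((-1) * (2 * Complex.I / k)) j (-(n - j + i))).symm).eq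
  have := LinearMap.congr_fun e y
  simp only [Module.End.mul_apply] at this
  rw [this, show -(n - (j : ℤ) + i) = -n - i + j by ring]

theorem _root_.NappiWitten.expCoeff_succ_apply_eq_zero {τ : ℕ → Module.End ℂ M} (β : ℂ)
    (hτ : ∀ i j, Commute (τ i) (τ j)) {v : M} (hv : ∀ i, τ (i + 1) v = 0) (n : ℕ) :
    expCoeff τ β (n + 1) v = 0 := by
  rw [expCoeff_succ, LinearMap.smul_apply, LinearMap.sum_apply, sum_eq_zero, smul_zero]
  intro i _
  rw [(commute_expCoeff β (fun j => hτ _ j) _).eq, Module.End.mul_apply, hv, map_zero]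

theorem vertex_apply_eq_zero (hC : CartanCurrents k J T) (hP : ChargedField J T η P) {v : M}
    (hT : ∀ n, 0 < n → T n v = 0) {n : ℤ} (hPv : ∀ m, n ≤ m → P m v = 0) :
    vertexField k T η P n v = 0 := by
  have half : halfVertex k T η P n v = 0 := by
    obtain ⟨K, hK⟩ := (((hP.dressable_half _) n).locSum_eventually v).exists
    refine hK.trans (sum_eq_zero fun i _ => ?_)
    rw [Module.End.mul_apply, hPv _ (by omega), map_zero]
  obtain ⟨K, hK⟩ := (((hP.dressable hC _) n).locSum_eventually v).exists
  refine hK.trans (sum_eq_zero fun j _ => ?_)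
  rcases j with _ | j
  · rw [expCoeff_zero, one_mul]
    simpa using half
  · rw [← (commute_expCoeff _ (fun l => (hP.T_half hC l _).symm) _).eq, Module.End.mul_apply,
      expCoeff_succ_apply_eq_zero _ (fun _ _ => hC.T_T _ _) (fun i => hT _ (by positivity)), map_zero]

end ChargedField

end VertexField

end NappiWitten

namespace NappiWitten

open MvPolynomial

/-! ### Fock space: orthogonal monomials, ladder operators, charge and filtration -/

section Fock

variable {σ : Type*} (lam : σ → ℝ)

/-- The squared norm of the monomial with exponents `m`, when the oscillator `i` has
squared norm `lam i`. -/
noncomputable def fockWeight (m : σ →₀ ℕ) : ℝ := m.prod fun i e => (e.factorial : ℝ) * lam i ^ e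

theorem fockWeight_add_single (m : σ →₀ ℕ) (i : σ) :
    fockWeight lam (m + Finsupp.single i 1) = fockWeight lam m * ((m i + 1) * lam i) := by
  classical
  have h0 : ∀ j, ((Nat.factorial 0 : ℕ) : ℝ) * lam j ^ 0 = 1 := by simp
  rw [fockWeight, fockWeight, Finsupp.prod_of_support_subset (s := insert i m.support) m
    (Finset.subset_insert _ _) _ (fun j _ => h0 j),
    Finsupp.prod_of_support_subset (s := insert i m.support) (m + Finsupp.single i 1) ?_ _
    (fun j _ => h0 j), ← Finset.mul_prod_erase _ _ (Finset.mem_insert_self i _),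
    ← Finset.mul_prod_erase _ _ (Finset.mem_insert_self i m.support)]
  · have : ∀ j ∈ (insert i m.support).erase i,
        (((m + Finsupp.single i 1 : σ →₀ ℕ) j).factorial : ℝ) *
          lam j ^ ((m + Finsupp.single i 1 : σ →₀ ℕ) j) =
        ((m j).factorial : ℝ) * lam j ^ (m j) := by
      intro j hj
      rw [Finset.mem_erase] at hj
      simp [hj.1.symm]
    rw [Finset.prod_congr rfl this]
    simp only [Finsupp.add_apply, Finsupp.single_eq_same, Nat.factorial_succ, pow_succ]
    push_cast
    ring
  · intro j hj
    rw [Finset.mem_insert, Finsupp.mem_support_iff]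
    by_contra! h
    rw [Finsupp.mem_support_iff] at hj
    exact hj (by simp [h.1.symm, h.2])

theorem fockWeight_nonneg (m : σ →₀ ℕ) (h : ∀ i, m i ≠ 0 → 0 ≤ lam i) : 0 ≤ fockWeight lam m :=
  Finset.prod_nonneg fun i hi =>
    mul_nonneg (Nat.cast_nonneg _) (pow_nonneg (h i (Finsupp.mem_support_iff.1 hi)) _)

theorem fockSummand_support_left (f g : MvPolynomial σ ℂ) :
    (Function.support fun m =>
      (fockWeight lam m : ℂ) * starRingEnd ℂ (coeff m f) * coeff m g) ⊆ f.support := by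
  intro m hm
  rw [Finset.mem_coe, mem_support_iff]
  intro h
  simp [h] at hm

theorem fockSummand_support_right (f g : MvPolynomial σ ℂ) :
    (Function.support fun m =>
      (fockWeight lam m : ℂ) * starRingEnd ℂ (coeff m f) * coeff m g) ⊆ g.support := by
  intro m hm
  rw [Finset.mem_coe, mem_support_iff]
  intro h
  simp [h] at hm

theorem fockSummand_finite (f g : MvPolynomial σ ℂ) : (Function.support fun m =>
    (fockWeight lam m : ℂ) * starRingEnd ℂ (coeff m f) * coeff m g).Finite :=
  f.support.finite_toSet.subset (fockSummand_support_left lam f g)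

/-- The Hermitian form on the Fock space for which distinct monomials are orthogonal. -/
noncomputable def fockForm : MvPolynomial σ ℂ →ₗ⋆[ℂ] MvPolynomial σ ℂ →ₗ[ℂ] ℂ :=
  LinearMap.mk₂'ₛₗ (starRingEnd ℂ) (RingHom.id ℂ)
    (fun f g => ∑ᶠ m, (fockWeight lam m : ℂ) * starRingEnd ℂ (coeff m f) * coeff m g)
    (fun f f' g => by
      rw [← finsum_add_distrib (fockSummand_finite lam f g) (fockSummand_finite lam f' g)]
      simp [mul_add, add_mul])
    (fun c f g => by
      rw [smul_eq_mul, mul_finsum]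
      simp only [coeff_smul, smul_eq_mul, map_mul]
      exact finsum_congr fun m => by ring)
    (fun f g g' => by
      rw [← finsum_add_distrib (fockSummand_finite lam f g) (fockSummand_finite lam f g')]
      simp [mul_add])
    (fun c f g => by
      rw [smul_eq_mul, mul_finsum]
      simp only [coeff_smul, smul_eq_mul, RingHom.id_apply]
      exact finsum_congr fun m => by ring)

theorem fockForm_apply (f g : MvPolynomial σ ℂ) : fockForm lam f g =
    ∑ᶠ m, (fockWeight lam m : ℂ) * starRingEnd ℂ (coeff m f) * coeff m g := rfl

theorem fockForm_monomial (m : σ →₀ ℕ) (c : ℂ) (g : MvPolynomial σ ℂ) :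
    fockForm lam (monomial m c) g = fockWeight lam m * starRingEnd ℂ c * coeff m g := by
  classical
  rw [fockForm_apply, finsum_eq_single _ m]
  · simp
  · intro m' hm
    simp [coeff_monomial, hm.symm]

theorem fockForm_self (f : MvPolynomial σ ℂ) : fockForm lam f f =
    ∑ m ∈ f.support, (fockWeight lam m : ℂ) * Complex.normSq (coeff m f) := by
  rw [fockForm_apply, finsum_eq_finsetSum_of_support_subset (s := f.support)]
  · refine Finset.sum_congr rfl fun m _ => ?_
    rw [mul_assoc, Complex.normSq_eq_conj_mul_self]
  · exact fockSummand_support_left lam f f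

theorem fockForm_hermitian (f g : MvPolynomial σ ℂ) :
    starRingEnd ℂ (fockForm lam f g) = fockForm lam g f := by
  rw [fockForm_apply, fockForm_apply, finsum_eq_finsetSum_of_support_subset (s := f.support),
    finsum_eq_finsetSum_of_support_subset (s := f.support), map_sum]
  · refine Finset.sum_congr rfl fun m _ => ?_
    simp
    ring
  · exact fockSummand_support_right lam g f
  · exact fockSummand_support_left lam f g

/-- Multiplication by the variable `i` if `b` holds, and minus its adjoint otherwise. -/
noncomputable def ladder (b : Bool) (i : σ) : Module.End ℂ (MvPolynomial σ ℂ) :=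
  if b then LinearMap.mulLeft ℂ (MvPolynomial.X i)
  else -((lam i : ℂ) • (pderiv (R := ℂ) i).toLinearMap)

theorem ladder_true_apply (i : σ) (f : MvPolynomial σ ℂ) :
    ladder lam true i f = MvPolynomial.X i * f := rfl

theorem ladder_false_apply (i : σ) (f : MvPolynomial σ ℂ) :
    ladder lam false i f = -((lam i : ℂ) • pderiv i f) := rfl

theorem fockForm_X_mul (i : σ) (f g : MvPolynomial σ ℂ) :
    fockForm lam (MvPolynomial.X i * f) g = fockForm lam f ((lam i : ℂ) • pderiv i g) := by
  induction f using MvPolynomial.induction_on' with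
  | monomial m c =>
    rw [MvPolynomial.X, monomial_mul, one_mul, add_comm, fockForm_monomial, fockForm_monomial,
      fockWeight_add_single, coeff_smul, coeff_pderiv]
    simp
    ring
  | add p q hp hq => rw [mul_add, map_add, map_add, LinearMap.add_apply, LinearMap.add_apply, hp, hq]

theorem fockForm_ladder (b : Bool) (i : σ) (f g : MvPolynomial σ ℂ) :
    fockForm lam (ladder lam b i f) g = -fockForm lam f (ladder lam (!b) i g) := by
  cases b
  · rw [Bool.not_false, ladder_true_apply, ladder_false_apply, map_neg, LinearMap.neg_apply,
      ← fockForm_hermitian, ← fockForm_X_mul, fockForm_hermitian]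
  · rw [Bool.not_true, ladder_true_apply, ladder_false_apply, map_neg, neg_neg, fockForm_X_mul]

open Classical in
theorem ladder_comm (b b' : Bool) (i j : σ) :
    ladder lam b i * ladder lam b' j - ladder lam b' j * ladder lam b i =
      if i = j ∧ b ≠ b' then (if b then (lam i : ℂ) else -lam i) • 1 else 0 := by
  refine LinearMap.ext fun f => ?_
  have pd : pderiv i (pderiv j f) = pderiv j (pderiv i f) := by
    have : ⁅pderiv (R := ℂ) i, pderiv (R := ℂ) j⁆ = 0 := by
      apply MvPolynomial.derivation_ext
      intro l
      simp [Derivation.commutator_apply, pderiv_X, Pi.single_apply, apply_ite]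
    have := DFunLike.congr_fun this f
    rwa [Derivation.commutator_apply, Derivation.zero_apply, sub_eq_zero] at this
  cases b <;> cases b' <;> simp only [LinearMap.sub_apply, Module.End.mul_apply,
    ladder_true_apply, ladder_false_apply]
  · simp [pd, smul_comm (lam i : ℂ)]
  · by_cases h : i = j
    · subst h
      simp
    · simp [h, pderiv_X_of_ne (Ne.symm h)]
  · by_cases h : i = j
    · subst h
      simp
    · simp [h, pderiv_X_of_ne h]
  · simp
    ring

/-- The operator measuring the total charge, where the variable `i` has charge `q i`. -/
noncomputable def chargeOp (q : σ → ℝ) : Derivation ℂ (MvPolynomial σ ℂ) (MvPolynomial σ ℂ) :=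
  mkDerivation ℂ fun i => (q i : ℂ) • MvPolynomial.X i

theorem chargeOp_comm_ladder (q : σ → ℝ) (b : Bool) (i : σ) :
    (chargeOp q).toLinearMap * ladder lam b i - ladder lam b i * (chargeOp q).toLinearMap =
      (if b then (q i : ℂ) else -q i) • ladder lam b i := by
  refine LinearMap.ext fun f => ?_
  cases b <;> simp only [LinearMap.sub_apply, Module.End.mul_apply, LinearMap.smul_apply,
    ladder_true_apply, ladder_false_apply, Derivation.coeFn_coe]
  · have : ⁅chargeOp q, pderiv (R := ℂ) i⁆ = (-q i : ℂ) • pderiv i := by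
      classical
      apply MvPolynomial.derivation_ext
      intro l
      by_cases h : l = i
      · subst h
        simp [Derivation.commutator_apply, chargeOp]
      · simp [Derivation.commutator_apply, chargeOp, pderiv_X_of_ne h]
    have := DFunLike.congr_fun this f
    rw [Derivation.commutator_apply, sub_eq_iff_eq_add] at this
    rw [map_neg, Derivation.map_smul, this]
    simp only [Derivation.smul_apply, Bool.false_eq_true, if_false]
    module
  · rw [Derivation.leibniz, chargeOp, mkDerivation_X]
    simp only [smul_eq_mul, if_true, smul_mul_assoc, add_sub_cancel_left, mul_comm f]

/-- Monomials are eigenvectors with real eigenvalue. As they are also orthogonal, the charge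
operator is symmetric. -/
theorem chargeOp_monomial (q : σ → ℝ) (m : σ →₀ ℕ) : ∃ r : ℝ, ∀ c : ℂ,
    chargeOp q (monomial m c) = (r : ℂ) • monomial m c := by
  classical
  induction m using Finsupp.induction_linear with
  | zero => exact ⟨0, fun c => by simp [← C_apply]⟩
  | add f g hf hg =>
    obtain ⟨r, hr⟩ := hf
    obtain ⟨s, hs⟩ := hg
    refine ⟨r + s, fun c => ?_⟩
    rw [← mul_one c, ← monomial_mul, Derivation.leibniz, hr, hs]
    simp only [smul_eq_mul, mul_smul_comm]
    rw [mul_comm (monomial g 1) (monomial f c)]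
    push_cast
    module
  | single i n =>
    refine ⟨n * q i, fun c => ?_⟩
    rw [chargeOp, mkDerivation_monomial, Finsupp.sum_single_index (by simp)]
    rcases n with _ | n
    · simp
    · rw [smul_eq_mul, mul_smul_comm, MvPolynomial.X, monomial_mul, ← Finsupp.single_tsub,
        ← Finsupp.single_add, Nat.add_sub_cancel, smul_monomial, smul_monomial, smul_monomial]
      congr 1
      simp only [smul_eq_mul]
      push_cast
      ring

theorem fockForm_chargeOp (q : σ → ℝ) (f g : MvPolynomial σ ℂ) :
    fockForm lam (chargeOp q f) g = fockForm lam f (chargeOp q g) := by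
  classical
  induction f using MvPolynomial.induction_on' with
  | add p p' hp hq => rw [map_add, map_add, map_add, LinearMap.add_apply, LinearMap.add_apply, hp, hq]
  | monomial m c =>
    induction g using MvPolynomial.induction_on' with
    | add p p' hp hq => rw [map_add, map_add, map_add, hp, hq]
    | monomial m' c' =>
      obtain ⟨r, hr⟩ := chargeOp_monomial q m
      obtain ⟨s, hs⟩ := chargeOp_monomial q m'
      by_cases h : m' = m
      · subst h
        rw [hr, hr, map_smulₛₗ, LinearMap.smul_apply, map_smul, Complex.conj_ofReal]
      · rw [hr, hs, map_smulₛₗ, LinearMap.smul_apply, map_smul, fockForm_monomial, coeff_monomial,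
          if_neg h]
        simp

/-- The polynomials all of whose monomials have weight less than `d`. -/
def weightFil (w : σ → ℕ) (d : ℤ) : Submodule ℂ (MvPolynomial σ ℂ) where
  carrier := {f | ∀ m, coeff m f ≠ 0 → (Finsupp.weight w m : ℤ) < d}
  zero_mem' := fun m h => (h (coeff_zero m)).elim
  add_mem' := fun {f g} hf hg m h => by
    by_cases h' : coeff m f = 0
    · exact hg m fun h'' => h (by rw [coeff_add, h', h'', add_zero])
    · exact hf m h'
  smul_mem' := fun c f hf m h => hf m fun h' => h (by rw [coeff_smul, h', smul_zero])

theorem eq_zero_of_mem_weightFil {w : σ → ℕ} {d : ℤ} (hd : d ≤ 0) {f : MvPolynomial σ ℂ}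
    (hf : f ∈ weightFil w d) : f = 0 := by
  ext m
  by_contra h
  have := hf m h
  omega

theorem exists_mem_weightFil (w : σ → ℕ) (f : MvPolynomial σ ℂ) : ∃ d, f ∈ weightFil w d := by
  refine ⟨(f.support.sup (Finsupp.weight w) : ℕ) + 1, fun m hm => ?_⟩
  have := Finset.le_sup (f := Finsupp.weight w) (mem_support_iff.2 hm)
  omega

theorem pderiv_mem_weightFil {w : σ → ℕ} {d : ℤ} {f : MvPolynomial σ ℂ} (hf : f ∈ weightFil w d)
    (i : σ) : pderiv i f ∈ weightFil w (d - w i) := by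
  intro m hm
  rw [coeff_pderiv] at hm
  have := hf _ (left_ne_zero_of_mul hm)
  rw [map_add, Finsupp.weight_single] at this
  simp at this
  omega

theorem ladder_false_eventually (f : MvPolynomial σ ℂ) {ι : ℤ → σ}
    (hι : Function.Injective ι) : ∃ N : ℤ, ∀ n, N ≤ n → ladder lam false (ι n) f = 0 := by
  classical
  obtain ⟨N, hN⟩ := ((f.vars.finite_toSet.preimage hι.injOn).bddAbove)
  refine ⟨N + 1, fun n hn => ?_⟩
  rw [ladder_false_apply, pderiv_eq_zero_of_notMem_vars, smul_zero, neg_zero]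
  intro h
  have := hN (show n ∈ ι ⁻¹' (f.vars : Set σ) from h)
  omega

theorem coeff_eq_zero_of_pderiv_eq_zero {f : MvPolynomial σ ℂ} {i : σ} (h : pderiv i f = 0)
    {m : σ →₀ ℕ} (hm : coeff m f ≠ 0) : m i = 0 := by
  classical
  by_contra hi
  have e : m - Finsupp.single i 1 + Finsupp.single i 1 = m :=
    tsub_add_cancel_of_le (Finsupp.single_le_iff.2 (Nat.one_le_iff_ne_zero.2 hi))
  have := coeff_pderiv (i := i) f (m - Finsupp.single i 1)
  rw [h, coeff_zero, e] at this
  rcases mul_eq_zero.1 this.symm with h' | h'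
  · exact hm h'
  · exact (Nat.cast_add_one_ne_zero _) h'

end Fock

end NappiWitten

namespace NappiWitten

/-! ### Representations from families of operators, and the automorphism exchanging the series -/

section ModeRelations

variable {A : Type*} [Ring A] [Algebra ℂ A] {k b : ℝ}

/-- The commutation relations of the affine Nappi–Witten algebra, for a family of elements of an
associative algebra. -/
structure ModeRelations (k b : ℝ) (φ : Mode → A) : Prop where
  Jp_Jm : ∀ m n, φ (.Jp m) * φ (.Jm n) - φ (.Jm n) * φ (.Jp m) =
    (2 * Complex.I) • φ (.T (m + n)) + if m + n = 0 then ((k * m : ℝ) : ℂ) • 1 else 0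
  J_Jp : ∀ m n, φ (.J m) * φ (.Jp n) - φ (.Jp n) * φ (.J m) = Complex.I • φ (.Jp (m + n))
  J_Jm : ∀ m n, φ (.J m) * φ (.Jm n) - φ (.Jm n) * φ (.J m) = -(Complex.I • φ (.Jm (m + n)))
  J_T : ∀ m n, φ (.J m) * φ (.T n) - φ (.T n) * φ (.J m) =
    if m + n = 0 then ((k / 2 * m : ℝ) : ℂ) • 1 else 0
  J_J : ∀ m n, φ (.J m) * φ (.J n) - φ (.J n) * φ (.J m) =
    if m + n = 0 then ((k * b / 2 * m : ℝ) : ℂ) • 1 else 0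
  Jp_Jp : ∀ m n, Commute (φ (.Jp m)) (φ (.Jp n))
  Jm_Jm : ∀ m n, Commute (φ (.Jm m)) (φ (.Jm n))
  T_Jp : ∀ m n, Commute (φ (.T m)) (φ (.Jp n))
  T_Jm : ∀ m n, Commute (φ (.T m)) (φ (.Jm n))
  T_T : ∀ m n, Commute (φ (.T m)) (φ (.T n))

theorem algHom_central {B : Type*} [Ring B] [Algebra ℂ B] (f : FreeModes →ₐ[ℂ] B) (c : ℝ)
    (m n : ℤ) : f (central c m n) = if m + n = 0 then (c : ℂ) • 1 else 0 := by
  unfold central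
  split_ifs
  · rw [AlgHom.commutes, Algebra.algebraMap_eq_smul_one]
  · exact map_zero f

theorem ModeRelations.lift_eq {φ : Mode → A} (h : ModeRelations k b φ) ⦃x y : FreeModes⦄
    (hxy : CommRel k b x y) : FreeAlgebra.lift ℂ φ x = FreeAlgebra.lift ℂ φ y := by
  cases hxy with
  | Jp_Jm m n => simpa [algHom_central] using h.Jp_Jm m n
  | J_Jp m n => simpa using h.J_Jp m n
  | J_Jm m n => simpa using h.J_Jm m n
  | J_T m n => simpa [algHom_central] using h.J_T m n
  | J_J m n => simpa [algHom_central] using h.J_J m n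
  | Jp_Jp m n => simpa [sub_eq_zero] using (h.Jp_Jp m n).eq
  | Jm_Jm m n => simpa [sub_eq_zero] using (h.Jm_Jm m n).eq
  | T_Jp m n => simpa [sub_eq_zero] using (h.T_Jp m n).eq
  | T_Jm m n => simpa [sub_eq_zero] using (h.T_Jm m n).eq
  | T_T m n => simpa [sub_eq_zero] using (h.T_T m n).eq

/-- The homomorphism from the enveloping algebra determined by the images of the modes. -/
noncomputable def ModeRelations.lift {φ : Mode → A} (h : ModeRelations k b φ) :
    Env k b →ₐ[ℂ] A :=
  RingQuot.liftAlgHom ℂ ⟨FreeAlgebra.lift ℂ φ, h.lift_eq⟩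

theorem ModeRelations.lift_mode {φ : Mode → A} (h : ModeRelations k b φ) (g : Mode) :
    h.lift (mode k b g) = φ g := by
  rw [lift, mode, RingQuot.liftAlgHom_mkAlgHom_apply, FreeAlgebra.lift_ι_apply]

/-- The family obtained by exchanging `J⁺` with `J⁻` and reversing the signs of `J` and `T`. -/
def flip (φ : Mode → A) : Mode → A
  | .Jp n => φ (.Jm n)
  | .Jm n => φ (.Jp n)
  | .J n => -φ (.J n)
  | .T n => -φ (.T n)

theorem ModeRelations.flip {φ : Mode → A} (h : ModeRelations k b φ) :
    ModeRelations k b (flip φ) := by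
  constructor <;> intro m n <;> simp only [NappiWitten.flip]
  · rw [← neg_sub, h.Jp_Jm, add_comm n m, neg_add, smul_neg]
    congr 1
    split_ifs with hmn
    · rw [← neg_smul, show n = -m by omega]
      congr 1
      push_cast
      ring
    · rw [neg_zero]
  · rw [neg_mul, mul_neg, ← neg_sub', h.J_Jm, neg_neg]
  · rw [neg_mul, mul_neg, ← neg_sub', h.J_Jp]
  · rw [neg_mul_neg, neg_mul_neg, h.J_T]
  · rw [neg_mul_neg, neg_mul_neg, h.J_J]
  · exact h.Jm_Jm m n
  · exact h.Jp_Jp m n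
  · exact (h.T_Jm m n).neg_left
  · exact (h.T_Jp m n).neg_left
  · exact (h.T_T m n).neg_left.neg_right

end ModeRelations

end NappiWitten

/-! ### The free field realization -/

namespace NappiWitten

open Filter

/-- The oscillators: two families of bosons for the currents `X = J - T` and its orthogonal
complement `Y`, and the modes of a complex boson of charge `±1`. -/
inductive Osc : Type
  | X (n : ℕ)
  | Y (n : ℕ)
  | P (n : ℤ)

section Commutators

variable {A : Type*} [Ring A] {x x' y y' t t' z : A}

theorem commute_sub_sub (hx : x * x' - x' * x = z) (hy : y * y' - y' * y = -z)
    (h : Commute x y') (h' : Commute x' y) : Commute (y - x) (y' - x') := by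
  have e : (y - x) * (y' - x') - (y' - x') * (y - x) = (y * y' - y' * y) + (x * x' - x' * x) -
      (x * y' - y' * x) + (x' * y - y * x') := by noncomm_ring
  rw [Commute, SemiconjBy, ← sub_eq_zero, e, hx, hy, h.eq, h'.eq]
  simp

theorem comm_smul_sub [Algebra ℂ A] (c : ℂ) (hx : x * x' - x' * x = z) (h : Commute x y') :
    x * (c • (y' - x')) - c • (y' - x') * x = -c • z := by
  rw [mul_smul_comm, smul_mul_assoc, ← smul_sub, mul_sub, sub_mul, h.eq, sub_sub_sub_cancel_left,
    ← neg_sub, hx, smul_neg, neg_smul]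

theorem comm_add_add (h : Commute t t') :
    (x + t) * (x' + t') - (x' + t') * (x + t) =
      (x * x' - x' * x) + (x * t' - t' * x) - (x' * t - t * x') := by
  have e : (x + t) * (x' + t') - (x' + t') * (x + t) = (x * x' - x' * x) + (x * t' - t' * x) -
      (x' * t - t * x') + (t * t' - t' * t) := by noncomm_ring
  rw [e, h.eq, sub_self, add_zero]

end Commutators

section FreeField

open MvPolynomial

section Current

variable {σ : Type*} {lam : σ → ℝ}

variable (lam) in
/-- The modes of a free boson built from the oscillators `ι n`. -/
noncomputable def bosonMode (ι : ℕ → σ) (n : ℤ) : Module.End ℂ (MvPolynomial σ ℂ) :=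
  ladder lam (decide (n < 0)) (ι n.natAbs)

theorem ladder_commute {i j : σ} (h : i ≠ j) (b b' : Bool) :
    Commute (ladder lam b i) (ladder lam b' j) := by
  rw [Commute, SemiconjBy, ← sub_eq_zero, ladder_comm, if_neg fun h' => h h'.1]

theorem bosonMode_comm {ι : ℕ → σ} (hι : Function.Injective ι) {κ : ℝ}
    (hκ : ∀ n, lam (ι n) = -κ * n) (m n : ℤ) :
    bosonMode lam ι m * bosonMode lam ι n - bosonMode lam ι n * bosonMode lam ι m =
      if m + n = 0 then ((κ * m : ℝ) : ℂ) • 1 else 0 := by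
  rw [bosonMode, bosonMode, ladder_comm, hι.eq_iff, hκ]
  by_cases hmn : m + n = 0
  · rw [if_pos hmn]
    obtain rfl : n = -m := by omega
    rcases lt_trichotomy m 0 with hm | rfl | hm
    · rw [if_pos ⟨by omega, by simp; omega⟩, if_pos (by simpa using hm), Nat.cast_natAbs,
        abs_of_neg hm]
      congr 2
      push_cast
      ring
    · simp
    · rw [if_pos ⟨by omega, by simp; omega⟩, if_neg (by simpa using hm.le), Nat.cast_natAbs,
        abs_of_pos hm]
      congr 1
      push_cast
      ring
  · rw [if_neg hmn, if_neg]
    rintro ⟨h1, h2⟩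
    apply h2
    rw [decide_eq_decide]
    omega

theorem fockForm_bosonMode {ι : ℕ → σ} {n : ℤ} (hn : n ≠ 0)
    (f g : MvPolynomial σ ℂ) : fockForm lam (bosonMode lam ι n f) g =
      -fockForm lam f (bosonMode lam ι (-n) g) := by
  rw [bosonMode, fockForm_ladder, bosonMode, Int.natAbs_neg]
  congr 4
  rw [← decide_not, decide_eq_decide]
  omega

theorem ladder_false_one (i : σ) : ladder lam false i 1 = 0 := by
  rw [ladder_false_apply, pderiv_one, smul_zero, neg_zero]

end Current

variable (k p pm : ℝ)

/-- The squared norms of the oscillators. -/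
noncomputable def Osc.norm : Osc → ℝ
  | .X n => -(1 - k) * n
  | .Y n => -(k - 1) * n
  | .P n => if n < 0 then k * n - 2 * p else 2 * p - k * n

/-- The charges of the oscillators. -/
noncomputable def Osc.charge : Osc → ℝ
  | .P n => if n < 0 then 1 else -1
  | _ => 0

/-- The energies of the oscillators of the neutral currents. -/
def Osc.energy : Osc → ℕ
  | .X n => n
  | .Y n => n
  | .P _ => 0

/-- The modes of the current `X`. -/
noncomputable abbrev modeX : ℤ → Module.End ℂ (MvPolynomial Osc ℂ) :=
  bosonMode (Osc.norm k p) .X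

/-- The modes of the current `Y`. -/
noncomputable abbrev modeY : ℤ → Module.End ℂ (MvPolynomial Osc ℂ) :=
  bosonMode (Osc.norm k p) .Y

/-- The modes of the null current `T`. -/
noncomputable def modeT (n : ℤ) : Module.End ℂ (MvPolynomial Osc ℂ) :=
  if n = 0 then (Complex.I * p) • 1 else (k / (2 * (k - 1)) : ℂ) • (modeY k p n - modeX k p n)

/-- The modes of the current `J`. -/
noncomputable def modeJ (n : ℤ) : Module.End ℂ (MvPolynomial Osc ℂ) :=
  if n = 0 then (Complex.I * pm) • 1 + Complex.I • (chargeOp Osc.charge).toLinearMap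
  else modeX k p n + modeT k p n

/-- The modes of the free field of charge `1`. -/
noncomputable def modePp (n : ℤ) : Module.End ℂ (MvPolynomial Osc ℂ) :=
  ladder (Osc.norm k p) (decide (n < 0)) (.P n)

/-- The modes of the free field of charge `-1`. -/
noncomputable def modePm (n : ℤ) : Module.End ℂ (MvPolynomial Osc ℂ) :=
  ladder (Osc.norm k p) (decide (n ≤ 0)) (.P (-n))

variable {k p pm}

theorem modeX_comm (m n : ℤ) : modeX k p m * modeX k p n - modeX k p n * modeX k p m =
    if m + n = 0 then (((1 - k) * m : ℝ) : ℂ) • 1 else 0 :=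
  bosonMode_comm (fun _ _ h => Osc.X.inj h) (fun _ => rfl) m n

theorem modeY_comm (m n : ℤ) : modeY k p m * modeY k p n - modeY k p n * modeY k p m =
    if m + n = 0 then (((k - 1) * m : ℝ) : ℂ) • 1 else 0 :=
  bosonMode_comm (fun _ _ h => Osc.Y.inj h) (fun _ => rfl) m n

theorem modeX_modeY (m n : ℤ) : Commute (modeX k p m) (modeY k p n) :=
  ladder_commute (by simp) _ _

/-- `X` and `Y` commute and have opposite levels, so the contributions to `[T, T]` cancel: `T` is
null. -/
theorem modeT_modeT (m n : ℤ) : Commute (modeT k p m) (modeT k p n) := by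
  unfold modeT
  split_ifs
  · exact ((Commute.one_left _).smul_left _).smul_right _
  · exact (Commute.one_left _).smul_left _
  · exact (Commute.one_right _).smul_right _
  · refine Commute.smul_left (Commute.smul_right ?_ _) _
    refine commute_sub_sub (modeX_comm m n) ?_ (modeX_modeY m n) (modeX_modeY n m)
    rw [modeY_comm]
    split_ifs
    · rw [show (k - 1) * (m : ℝ) = -((1 - k) * m) by ring, Complex.ofReal_neg]
      exact neg_smul _ (_ : Module.End ℂ (MvPolynomial Osc ℂ))
    · exact neg_zero.symm

/-- This fixes the normalization of `T`: the factor `k / (2 (k - 1))` times the level `1 - k` of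
`X`, with the sign of `-X`, is `k / 2`. -/
theorem modeX_modeT (hk : k < 0) (m : ℤ) {n : ℤ} (hn : n ≠ 0) :
    modeX k p m * modeT k p n - modeT k p n * modeX k p m =
      if m + n = 0 then ((k / 2 * m : ℝ) : ℂ) • 1 else 0 := by
  have hk1 : (k : ℂ) - 1 ≠ 0 := by
    have : k - 1 ≠ 0 := by linarith
    exact_mod_cast this
  rw [modeT, if_neg hn]
  refine (comm_smul_sub _ (modeX_comm m n) (modeX_modeY m n)).trans ?_
  split_ifs
  · rw [smul_smul]
    congr 1
    push_cast
    field_simp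
    ring
  · exact smul_zero _

theorem chargeOp_commute_bosonMode {ι : ℕ → Osc} (hι : ∀ n, (ι n).charge = 0) (n : ℤ) :
    Commute (chargeOp Osc.charge).toLinearMap (bosonMode (Osc.norm k p) ι n) := by
  rw [Commute, SemiconjBy, ← sub_eq_zero, bosonMode, chargeOp_comm_ladder, hι]
  simp

theorem modeJ_zero_bosonMode {ι : ℕ → Osc} (hι : ∀ n, (ι n).charge = 0) (n : ℤ) :
    Commute (modeJ k p pm 0) (bosonMode (Osc.norm k p) ι n) := by
  rw [modeJ, if_pos rfl]
  exact ((Commute.one_left _).smul_left _).add_left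
    ((chargeOp_commute_bosonMode hι n).smul_left _)

theorem modeJ_zero_modeT (n : ℤ) : Commute (modeJ k p pm 0) (modeT k p n) := by
  unfold modeT
  split_ifs
  · exact (Commute.one_right _).smul_right _
  · exact ((modeJ_zero_bosonMode (fun _ => rfl) n).sub_right
      (modeJ_zero_bosonMode (fun _ => rfl) n)).smul_right _

theorem modeJ_modeT (hk : k < 0) (m n : ℤ) :
    modeJ k p pm m * modeT k p n - modeT k p n * modeJ k p pm m =
      if m + n = 0 then ((k / 2 * m : ℝ) : ℂ) • 1 else 0 := by
  rcases eq_or_ne m 0 with rfl | hm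
  · rw [(modeJ_zero_modeT n).eq]
    simp
  rcases eq_or_ne n 0 with rfl | hn
  · rw [if_neg (by simpa using hm), modeT, if_pos rfl]
    simp
  · rw [modeJ, if_neg hm, add_mul, mul_add, (modeT_modeT m n).eq, add_sub_add_right_eq_sub,
      modeX_modeT hk m hn]

theorem modeJ_modeJ (hk : k < 0) (m n : ℤ) :
    modeJ k p pm m * modeJ k p pm n - modeJ k p pm n * modeJ k p pm m =
      if m + n = 0 then ((k * (2 / k) / 2 * m : ℝ) : ℂ) • 1 else 0 := by
  have h0 : ∀ n, Commute (modeJ k p pm 0) (modeJ k p pm n) := by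
    intro n
    rcases eq_or_ne n 0 with rfl | hn
    · exact Commute.refl _
    · rw [modeJ.eq_def _ _ _ n, if_neg hn]
      exact (modeJ_zero_bosonMode (fun _ => rfl) n).add_right (modeJ_zero_modeT n)
  rcases eq_or_ne m 0 with rfl | hm
  · rw [(h0 n).eq]
    simp
  rcases eq_or_ne n 0 with rfl | hn
  · rw [if_neg (by simpa using hm), (h0 m).eq, sub_self]
  rw [modeJ, if_neg hm, modeJ, if_neg hn]
  refine (comm_add_add (modeT_modeT m n)).trans ?_
  rw [modeX_comm, modeX_modeT hk m hn, modeX_modeT hk n hm, add_comm n m]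
  split_ifs with hmn
  · obtain rfl : n = -m := by omega
    rw [← add_smul, ← sub_smul]
    congr 1
    -- The value `b = 2 / k` is what makes the level of `J` equal to `1 = (1 - k) + k / 2 + k / 2`,
    -- from `X` with itself and the two cross terms with `T`.
    have : k * (2 / k) / 2 = 1 := by
      have := hk.ne
      field_simp
    rw [this]
    push_cast
    ring
  · exact (sub_zero _).trans (add_zero _)

/-- The coefficient of index `j` lowers the energy in the `X` and `Y` oscillators by `j`, and a
polynomial has bounded energy. -/
theorem modeT_expCoeff_fin (β : ℂ) :
    LocallyFinite (expCoeff (fun l : ℕ => modeT k p l) β) := by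
  intro v
  obtain ⟨d, hd⟩ := exists_mem_weightFil Osc.energy v
  filter_upwards [eventually_ge_atTop d.toNat] with j hj
  refine eq_zero_of_mem_weightFil (w := Osc.energy) (d := d - j) (by omega)
    (expCoeff_mem β (weightFil Osc.energy) (fun i d v hv => ?_) j d v hd)
  have lad : ∀ {o : Osc}, o.energy = i + 1 →
      ladder (Osc.norm k p) false o v ∈ weightFil Osc.energy (d - (i + 1)) := by
    intro o ho
    rw [ladder_false_apply]
    refine Submodule.neg_mem _ (Submodule.smul_mem _ _ ?_)
    have := pderiv_mem_weightFil hv o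
    rw [ho] at this
    exact_mod_cast this
  have neg : decide (((i + 1 : ℕ) : ℤ) < 0) = false := by simp; omega
  rw [modeT, if_neg (by omega), LinearMap.smul_apply, LinearMap.sub_apply]
  unfold modeX modeY bosonMode
  rw [neg]
  exact Submodule.smul_mem _ _ (Submodule.sub_mem _ (lad rfl) (lad rfl))

theorem cartanCurrents (hk : k < 0) : CartanCurrents k (modeJ k p pm) (modeT k p) where
  J_T m n := by rw [modeJ_modeT hk]; push_cast; rfl
  T_T := modeT_modeT
  T_fin := modeT_expCoeff_fin

theorem modeT_commute_ladder (m n : ℤ) (b : Bool) :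
    Commute (modeT k p m) (ladder (Osc.norm k p) b (.P n)) := by
  unfold modeT
  split_ifs
  · exact (Commute.one_left _).smul_left _
  · exact ((ladder_commute (by simp) _ _).sub_left (ladder_commute (by simp) _ _)).smul_left _

theorem modeJ_commute_ladder {m : ℤ} (hm : m ≠ 0) (n : ℤ) (b : Bool) :
    Commute (modeJ k p pm m) (ladder (Osc.norm k p) b (.P n)) := by
  rw [modeJ, if_neg hm]
  exact (ladder_commute (by simp) _ _).add_left (modeT_commute_ladder m n b)

theorem modeJ_zero_ladder (n : ℤ) (b : Bool) :
    modeJ k p pm 0 * ladder (Osc.norm k p) b (.P n) - ladder (Osc.norm k p) b (.P n) *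
      modeJ k p pm 0 = (Complex.I * (if b then (Osc.charge (.P n) : ℂ) else -Osc.charge (.P n))) •
        ladder (Osc.norm k p) b (.P n) := by
  rw [mul_smul, ← chargeOp_comm_ladder, modeJ, if_pos rfl]
  simp only [add_mul, mul_add, smul_mul_assoc, mul_smul_comm, one_mul, mul_one, smul_sub]
  abel

theorem chargedField_modePp : ChargedField (modeJ k p pm) (modeT k p) 1 (modePp k p) where
  T_P m n := modeT_commute_ladder m n _
  J_P m n hm := modeJ_commute_ladder hm n _
  J_zero_P n := by
    rw [modePp, modeJ_zero_ladder]
    congr 1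
    by_cases hn : n < 0 <;> simp [Osc.charge, hn]
  P_fin v := by
    obtain ⟨N, hN⟩ := ladder_false_eventually (Osc.norm k p) v (ι := Osc.P)
      fun _ _ h => Osc.P.inj h
    refine ⟨max N 0, fun n hn => ?_⟩
    rw [modePp, decide_eq_false (by omega)]
    exact hN n (by omega)

theorem chargedField_modePm : ChargedField (modeJ k p pm) (modeT k p) (-1) (modePm k p) where
  T_P m n := modeT_commute_ladder m _ _
  J_P m n hm := modeJ_commute_ladder hm _ _
  J_zero_P n := by
    rw [modePm, modeJ_zero_ladder]
    congr 1
    by_cases hn : n ≤ 0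
    · simp [Osc.charge, hn, not_lt.2 hn]
    · simp [Osc.charge, hn, not_le.1 hn]
  P_fin v := by
    obtain ⟨N, hN⟩ := ladder_false_eventually (Osc.norm k p) v (ι := fun n => Osc.P (-n))
      fun _ _ h => neg_injective (Osc.P.inj h)
    -- The bound starts at `1`, not `0`, since the zero mode of the field of charge `-1` is a
    -- creation operator.
    refine ⟨max N 1, fun n hn => ?_⟩
    rw [modePm, decide_eq_false (by omega)]
    exact hN n (by omega)

theorem modePp_modePm (m n : ℤ) : modePp k p m * modePm k p n - modePm k p n * modePp k p m =
    if m + n = 0 then (2 * Complex.I) • modeT k p 0 + ((k : ℂ) * m) • 1 else 0 := by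
  rw [modePp, modePm, ladder_comm, modeT, if_pos rfl]
  by_cases hmn : m + n = 0
  · obtain rfl : n = -m := by omega
    rw [if_pos hmn, smul_smul, ← add_smul, if_pos ⟨by simp, by simp; omega⟩]
    congr 1
    have hI : (2 * Complex.I) * (Complex.I * p) = -(2 * p) := by
      linear_combination (2 * (p : ℂ)) * Complex.I_mul_I
    rw [hI]
    by_cases hm : m < 0
    · simp [Osc.norm, hm]; ring
    · simp [Osc.norm, hm]; ring
  · rw [if_neg hmn, if_neg]
    rintro ⟨h, -⟩
    have := Osc.P.inj h
    omega

theorem modePp_modePp (m n : ℤ) : Commute (modePp k p m) (modePp k p n) := by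
  rw [Commute, SemiconjBy, ← sub_eq_zero, modePp, modePp, ladder_comm, if_neg]
  rintro ⟨h, h'⟩
  rw [Osc.P.inj h] at h'
  exact h' rfl

theorem modePm_modePm (m n : ℤ) : Commute (modePm k p m) (modePm k p n) := by
  rw [Commute, SemiconjBy, ← sub_eq_zero, modePm, modePm, ladder_comm, if_neg]
  rintro ⟨h, h'⟩
  rw [neg_injective (Osc.P.inj h)] at h'
  exact h' rfl

variable (k p pm) in
/-- The free field realization of the modes. -/
noncomputable def freeField : Mode → Module.End ℂ (MvPolynomial Osc ℂ)
  | .Jp n => vertexField k (modeT k p) 1 (modePp k p) n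
  | .Jm n => vertexField k (modeT k p) (-1) (modePm k p) n
  | .J n => modeJ k p pm n
  | .T n => modeT k p n

theorem modeRelations_freeField (hk : k < 0) : ModeRelations k (2 / k) (freeField k p pm) := by
  have hC := cartanCurrents (p := p) (pm := pm) hk
  have hp := chargedField_modePp (k := k) (p := p) (pm := pm)
  have hm := chargedField_modePm (k := k) (p := p) (pm := pm)
  constructor <;> intro m n <;> simp only [freeField]
  · rw [hp.vertex_comm hk.ne hC hm modePp_modePm]
    push_cast
    rfl
  · rw [hp.J_vertex hk.ne hC, one_mul]
  · rw [hm.J_vertex hk.ne hC, neg_one_mul]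
    exact neg_smul _ (_ : Module.End ℂ (MvPolynomial Osc ℂ))
  · exact modeJ_modeT hk m n
  · exact modeJ_modeJ hk m n
  · exact hp.commute_vertex hC hp modePp_modePp m n
  · exact hm.commute_vertex hC hm modePm_modePm m n
  · exact hp.T_vertex hC m n
  · exact hm.T_vertex hC m n
  · exact modeT_modeT m n

theorem fockForm_modeT (n : ℤ) (x y : MvPolynomial Osc ℂ) :
    fockForm (Osc.norm k p) (modeT k p n x) y = -fockForm (Osc.norm k p) x (modeT k p (-n) y) := by
  rcases eq_or_ne n 0 with rfl | hn
  · simp [modeT]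
  · simp only [modeT, hn, neg_eq_zero, if_false, LinearMap.smul_apply, LinearMap.sub_apply,
      map_smulₛₗ, map_sub]
    rw [fockForm_bosonMode hn, fockForm_bosonMode hn]
    simp [map_ofNat]
    ring

theorem fockForm_modeJ (n : ℤ) (x y : MvPolynomial Osc ℂ) :
    fockForm (Osc.norm k p) (modeJ k p pm n x) y =
      -fockForm (Osc.norm k p) x (modeJ k p pm (-n) y) := by
  rcases eq_or_ne n 0 with rfl | hn
  · simp [modeJ, fockForm_chargeOp]
    ring
  · simp only [modeJ, hn, neg_eq_zero, if_false, LinearMap.add_apply, map_add]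
    rw [fockForm_bosonMode hn, fockForm_modeT]
    ring

theorem fockForm_modePp (n : ℤ) (x y : MvPolynomial Osc ℂ) :
    fockForm (Osc.norm k p) (modePp k p n x) y =
      -fockForm (Osc.norm k p) x (modePm k p (-n) y) := by
  rw [modePp, fockForm_ladder, modePm, neg_neg]
  congr 4
  rw [← decide_not, decide_eq_decide]
  omega

theorem fockForm_freeField (hk : k < 0) (g : Mode) (x y : MvPolynomial Osc ℂ) :
    fockForm (Osc.norm k p) (freeField k p pm g x) y =
      -fockForm (Osc.norm k p) x (freeField k p pm g.conj y) := by
  have key := fun n x y => ChargedField.vertex_adjoint (cartanCurrents (p := p) (pm := pm) hk)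
    chargedField_modePp chargedField_modePm (fockForm (Osc.norm k p)) fockForm_modeT
      fockForm_modePp n x y
  cases g with
  | Jp n => exact key n x y
  | Jm n =>
    -- The adjoint of `J⁻` follows from that of `J⁺` by Hermitian symmetry.
    have := congrArg (starRingEnd ℂ) (key (-n) y x)
    rw [map_neg, fockForm_hermitian, fockForm_hermitian, neg_neg] at this
    rw [freeField, Mode.conj, freeField, this, neg_neg]
  | J n => exact fockForm_modeJ n x y
  | T n => exact fockForm_modeT n x y

theorem bosonMode_one {ι : ℕ → Osc} {n : ℤ} (hn : 0 < n) :
    bosonMode (Osc.norm k p) ι n 1 = 0 := by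
  rw [bosonMode, decide_eq_false (by omega), ladder_false_one]

theorem modeT_one {n : ℤ} (hn : 0 < n) : modeT k p n 1 = 0 := by
  rw [modeT, if_neg hn.ne', LinearMap.smul_apply, LinearMap.sub_apply, bosonMode_one hn,
    bosonMode_one hn, sub_zero, smul_zero]

theorem modeJ_one {n : ℤ} (hn : 0 < n) : modeJ k p pm n 1 = 0 := by
  rw [modeJ, if_neg hn.ne', LinearMap.add_apply, bosonMode_one hn, modeT_one hn, add_zero]

theorem freeField_Jp_one (hk : k < 0) {n : ℤ} (hn : 0 ≤ n) : freeField k p pm (.Jp n) 1 = 0 :=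
  chargedField_modePp.vertex_apply_eq_zero (cartanCurrents (pm := pm) hk)
    (fun _ h => modeT_one h) fun m hm => by
      rw [modePp, decide_eq_false (by omega), ladder_false_one]

theorem freeField_Jm_one (hk : k < 0) {n : ℤ} (hn : 0 < n) : freeField k p pm (.Jm n) 1 = 0 :=
  chargedField_modePm.vertex_apply_eq_zero (cartanCurrents (pm := pm) hk)
    (fun _ h => modeT_one h) fun m hm => by
      rw [modePm, decide_eq_false (by omega), ladder_false_one]

theorem modeT_zero_one : modeT k p 0 1 = (Complex.I * p) • 1 := by
  rw [modeT, if_pos rfl]; rfl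

theorem modeJ_zero_one : modeJ k p pm 0 1 = (Complex.I * pm) • 1 := by
  simp [modeJ]

/-- Only the `X` oscillators have negative norm. Being primary means that all derivatives by the
variables `X n`, `n > 0`, vanish, so every monomial of the state is a product of oscillators of
nonnegative norm, and monomials are orthogonal. -/
theorem fockForm_primary_nonneg (hk : k < 0) (hp : 0 < p) (hpk : p ≤ -k / 2)
    {x : MvPolynomial Osc ℂ} (hx : ∀ n : ℤ, 0 < n → modeX k p n x = 0) :
    0 ≤ (fockForm (Osc.norm k p) x x).re := by
  rw [fockForm_self, Complex.re_sum]
  refine Finset.sum_nonneg fun m hm => ?_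
  rw [← Complex.ofReal_mul, Complex.ofReal_re]
  refine mul_nonneg (fockWeight_nonneg _ _ fun o ho => ?_) (Complex.normSq_nonneg _)
  cases o with
  | X n =>
    rcases Nat.eq_zero_or_pos n with rfl | hn
    -- The index `0` is not restricted by the primary condition, but its norm is zero.
    · simp [Osc.norm]
    · exfalso
      apply ho
      refine coeff_eq_zero_of_pderiv_eq_zero ?_ (mem_support_iff.1 hm)
      have := hx n (by omega)
      unfold modeX bosonMode at this
      rw [decide_eq_false (by omega), Int.natAbs_natCast, ladder_false_apply,
        neg_eq_zero, smul_eq_zero] at this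
      refine this.resolve_left fun h => ?_
      rw [Complex.ofReal_eq_zero, Osc.norm] at h
      have : (0 : ℝ) < n := by exact_mod_cast hn
      nlinarith
  | Y n =>
    rw [Osc.norm]
    exact mul_nonneg (by linarith) (Nat.cast_nonneg n)
  | P n =>
    rw [Osc.norm]
    split_ifs with hn
    -- The worst case is `n = -1`, with norm `-k - 2 p`: this is where the upper bound on `p`
    -- enters, and equality gives a null oscillator. For `n ≥ 0` the worst case is `n = 0`, with
    -- norm `2 p`.
    · have : (n : ℝ) ≤ -1 := by exact_mod_cast (by omega : n ≤ -1)
      nlinarith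
    · have : (0 : ℝ) ≤ n := by exact_mod_cast not_lt.1 hn
      nlinarith

end FreeField

/-! ### Unitarity of the two series -/

theorem fockForm_one {lam : Osc → ℝ} : fockForm lam 1 1 = 1 := by
  have := fockForm_monomial lam 0 1 1
  rw [MvPolynomial.monomial_zero', MvPolynomial.C_1] at this
  rw [this]
  simp [fockWeight]

theorem cosetUnitary_highest {k pp : ℝ} (pm : ℝ) (hk : k < 0) (hp : 0 < pp) (hpk : pp ≤ -k / 2) :
    CosetUnitary k (2 / k) .highest pp pm := by
  have hφ := modeRelations_freeField (p := pp) (pm := pm) hk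
  refine cosetUnitary_of_representation hφ.lift 1 ?_ (fockForm (Osc.norm k pp))
    (fockForm_hermitian _) (fun g x y => ?_) fockForm_one fun x hx => ?_
  · intro x hx
    cases hx with
    | Jp n hn => rw [hφ.lift_mode]; exact freeField_Jp_one hk hn.le
    | Jm n hn => rw [hφ.lift_mode]; exact freeField_Jm_one hk hn
    | J n hn => rw [hφ.lift_mode]; exact modeJ_one hn
    | T n hn => rw [hφ.lift_mode]; exact modeT_one hn
    | zero => rw [hφ.lift_mode]; exact freeField_Jp_one hk le_rfl
    | T_zero =>
      rw [map_sub, hφ.lift_mode, AlgHom.commutes, LinearMap.sub_apply, freeField, modeT_zero_one,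
        Module.algebraMap_end_apply, sub_self]
    | J_zero =>
      rw [map_sub, hφ.lift_mode, AlgHom.commutes, LinearMap.sub_apply, freeField, modeJ_zero_one,
        Module.algebraMap_end_apply, sub_self]
  · rw [hφ.lift_mode, hφ.lift_mode]
    exact fockForm_freeField hk g x y
  · refine fockForm_primary_nonneg hk hp hpk fun n hn => ?_
    have := hx n hn
    rwa [X, map_sub, hφ.lift_mode, hφ.lift_mode, freeField, freeField, modeJ, if_neg hn.ne',
      add_sub_cancel_right] at this

/-- The same Fock space with `p⁺` and `p⁻` negated, seen through the automorphism that swaps `J⁺`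
with `J⁻` and negates `J` and `T`. It sends `X` to `-X`, so the primary condition is unchanged. -/
theorem cosetUnitary_lowest {k pp : ℝ} (pm : ℝ) (hk : k < 0) (hpk : k / 2 ≤ pp) (hp : pp < 0) :
    CosetUnitary k (2 / k) .lowest pp pm := by
  have hφ := (modeRelations_freeField (p := -pp) (pm := -pm) hk).flip
  refine cosetUnitary_of_representation hφ.lift 1 ?_ (fockForm (Osc.norm k (-pp)))
    (fockForm_hermitian _) (fun g x y => ?_) fockForm_one fun x hx => ?_
  · intro x hx
    cases hx with
    | Jp n hn => rw [hφ.lift_mode]; exact freeField_Jm_one (pm := -pm) hk hn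
    | Jm n hn => rw [hφ.lift_mode]; exact freeField_Jp_one (pm := -pm) hk hn.le
    | J n hn =>
      rw [hφ.lift_mode, flip, LinearMap.neg_apply, neg_eq_zero]
      exact modeJ_one hn
    | T n hn =>
      rw [hφ.lift_mode, flip, LinearMap.neg_apply, neg_eq_zero]
      exact modeT_one hn
    | zero => rw [hφ.lift_mode]; exact freeField_Jp_one (pm := -pm) hk le_rfl
    | T_zero =>
      rw [map_sub, hφ.lift_mode, AlgHom.commutes, LinearMap.sub_apply, flip, LinearMap.neg_apply,
        freeField, modeT_zero_one, Module.algebraMap_end_apply]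
      simp
    | J_zero =>
      rw [map_sub, hφ.lift_mode, AlgHom.commutes, LinearMap.sub_apply, flip, LinearMap.neg_apply,
        freeField, modeJ_zero_one, Module.algebraMap_end_apply]
      simp
  · have key := fun g => fockForm_freeField (p := -pp) (pm := -pm) hk g x y
    rw [hφ.lift_mode, hφ.lift_mode]
    cases g with
    | Jp n => exact key (.Jm n)
    | Jm n => exact key (.Jp n)
    | J n => simpa [flip, Mode.conj] using congrArg Neg.neg (key (.J n))
    | T n => simpa [flip, Mode.conj] using congrArg Neg.neg (key (.T n))
  · refine fockForm_primary_nonneg hk (p := -pp) (by linarith) (by linarith) fun n hn => ?_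
    have := hx n hn
    rw [X, map_sub, hφ.lift_mode, hφ.lift_mode, flip, flip, freeField, freeField, ← neg_sub',
      modeJ, if_neg hn.ne', add_sub_cancel_right, LinearMap.neg_apply, neg_eq_zero] at this
    exact this

end NappiWitten

theorem mainTheorem2 (k : ℝ) (hk : k < 0) (pp pm : ℝ) :
    (0 < pp → pp ≤ -k / 2 →
      NappiWitten.CosetUnitary k (2 / k) NappiWitten.Series.highest pp pm) ∧
    (k / 2 ≤ pp → pp < 0 →
      NappiWitten.CosetUnitary k (2 / k) NappiWitten.Series.lowest pp pm) :=
  ⟨NappiWitten.cosetUnitary_highest pm hk, NappiWitten.cosetUnitary_lowest pm hk⟩
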